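/- **Setting.** Sites are $x=1,2,\dots$ and $\Lambda=\{1,\dots,L\}$. Let $(\lambda_x)$ be a uniformly bounded sequence of positive numbers ($0<\lambda_x\le C$ for all $x$). Let the weights $w_x(n)$, $n\ge 0$, satisfy $w_x(n+1)/w_x(n)\to 1$ as $n\to\infty$ for every $x$, together with the following uniform regularity: there are sequences $w_-,w_+$ with $$0<w_-(n)\le w_x(n)\le w_+(n)\ \text{ for all } n\ge 0,\ x\ge 1,\qquad \frac{w_\pm(n+1)}{w_\pm(n)}\to 1\ \text{ as } n\to\infty .$$ For $\phi\ge 0$ let $z_x(\phi)=\sum_{n\ge0}w_x(n)(\lambda_x\phi)^n$. When all $z_x(\phi)$ are finite, let $\nu_\phi^x$ be the probability measure on $\{0,1,2,\dots\}$ with $\nu_\phi^x(n)=w_x(n)(\lambda_x\phi)^n/z_x(\phi)$, let $\nu_\phi^\Lambda=\prod_{x\in\Lambda}\nu^x_\phi$, let $\nu_\phi$ be the infinite product $\prod_{x\ge1}\nu_\phi^x$, and put $R_x(\phi)=\sum_n n\,\nu_\phi^x(n)$. The canonical measure $\pi_{\Lambda,N}$ is the probability measure on $\{\eta\in\{0,1,2,\dots\}^\Lambda:\sum_{x\in\Lambda}\eta_x=N\}$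 proportional to $\prod_{x\in\Lambda}w_x(\eta_x)\lambda_x^{\eta_x}$. Let $\phi_c\in(0,\infty)$ be the supremum of those $\phi\ge0$ for which all $z_x(\phi)$ are finite. Assume that the limiting density $$R(\phi)=\lim_{L\to\infty}\frac1L\sum_{x=1}^L R_x(\phi)$$ exists for all $0\le\phi<\phi_c$, and let $\rho_c=\lim_{\phi\nearrow\phi_c}R(\phi)\in[0,\infty]$. Write $H(\mu_1;\mu_2)$ for relative entropy. A cylinder function is a real function of $\eta=(\eta_x)_{x\ge1}$ that depends on finitely many $\eta_x$. **Theorem.** Let $\rho>0$, and let $\phi\ge 0$ be such that all $z_x(\phi)$ are finite and the limit $R(\phi)$ exists and equals $\rho$. Let $L,N\to\infty$ with $N/L\to\rho$. 1. If $\rho<\rho_c$, then $\frac1L H(\pi_{\Lambda,N};\nu_\phi^\Lambda)\to0$. Moreover, $\pi_{\Lambda,N}(f)\to\nu_\phi(f)$ for every cylinder function $f$ that lies in $L^{1+\epsilon}(\nu_\phi)$ for some $\epsilon>0$. 2. Let $\rho=\rho_c$ and $\phi=\phi_c$ (so that $\nu_{\phi_c}$ exists and has limiting density $\rho_c$), and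 suppose that $\nu_{\phi_c}$ has finite second moments, $\nu_{\phi_c}(\eta_x^2)<\infty$ for every $x$. Then $\frac1LH(\pi_{\Lambda,N};\nu_{\phi_c}^\Lambda)\to0$. If in addition $\sum_{n\ge0} n\,w_-(n)=\infty$, or $\lambda_x<1/\phi_c$ for every $x$, then also $\pi_{\Lambda,N}(f)\to\nu_{\phi_c}(f)$ for every cylinder function $f$ that lies in $L^{1+\epsilon}(\nu_{\phi_c})$ for some $\epsilon>0$. -/

import Mathlib

open Filter Topology MeasureTheory
open scoped ENNReal

namespace Condensation

/-! The sites `1, 2, 3, …` are indexed by `0, 1, 2, …`, and the lattice of size `L` is `Fin L`.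
A system is given by a fugacity profile `lam : ℕ → ℝ` (positive numbers `lam x`) and
stationary weights `w : ℕ → ℕ → ℝ`, where `w x n` is the weight of `n` particles at site `x`. -/

noncomputable section

/-- Standing assumptions on the weights: they are subexponential at each site, and they lie between
two positive `x`-independent sequences `wm ≤ wp` that are themselves subexponential. -/
structure RegularWeights (w : ℕ → ℕ → ℝ) (wm wp : ℕ → ℝ) : Prop where
  wm_pos : ∀ n, 0 < wm n
  lower : ∀ x n, wm n ≤ w x n
  upper : ∀ x n, w x n ≤ wp n
  wm_ratio : Tendsto (fun n => wm (n + 1) / wm n) atTop (𝓝 1)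
  wp_ratio : Tendsto (fun n => wp (n + 1) / wp n) atTop (𝓝 1)
  w_ratio : ∀ x, Tendsto (fun n => w x (n + 1) / w x n) atTop (𝓝 1)

/-- The terms `w_x(n) (λ_x φ)^n` of the single-site partition function. -/
def siteWeight (lam : ℕ → ℝ) (w : ℕ → ℕ → ℝ) (φ : ℝ) (x n : ℕ) : ℝ≥0∞ :=
  ENNReal.ofReal (w x n * (lam x * φ) ^ n)

/-- The single-site partition function `z_x(φ) = ∑ₙ w_x(n) (λ_x φ)^n`, possibly infinite. -/
def sitePartition (lam : ℕ → ℝ) (w : ℕ → ℕ → ℝ) (φ : ℝ) (x : ℕ) : ℝ≥0∞ :=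
  ∑' n, siteWeight lam w φ x n

/-- The fugacities `φ ≥ 0` for which all marginals, hence the product measures, exist. -/
def fugacityDomain (lam : ℕ → ℝ) (w : ℕ → ℕ → ℝ) : Set ℝ :=
  {φ | 0 ≤ φ ∧ ∀ x, sitePartition lam w φ x ≠ ∞}

/-- The critical fugacity `φ_c`: the right end point of the interval of those `φ ≥ 0` for which
all `z_x(φ)` are finite, that is, the infimum of the radii of convergence. -/
def criticalFugacity (lam : ℕ → ℝ) (w : ℕ → ℕ → ℝ) : ℝ :=
  sSup (fugacityDomain lam w)

/-- The single-site marginal `ν_φ^x`, with mass function `w_x(n) (λ_x φ)^n / z_x(φ)`; a probability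
measure for `φ` in the domain. -/
def marginal (lam : ℕ → ℝ) (w : ℕ → ℕ → ℝ) (φ : ℝ) (x : ℕ) : Measure ℕ :=
  (sitePartition lam w φ x)⁻¹ • Measure.count.withDensity (siteWeight lam w φ x)

/-- The grand-canonical product measure `ν_φ^Λ` on the lattice of size `L`. -/
def grandCanonical (lam : ℕ → ℝ) (w : ℕ → ℕ → ℝ) (φ : ℝ) (L : ℕ) : Measure (Fin L → ℕ) :=
  Measure.pi fun x : Fin L => marginal lam w φ x

/-- The grand-canonical product measure `ν_φ` on the infinite lattice. -/
def grandCanonicalInf (lam : ℕ → ℝ) (w : ℕ → ℕ → ℝ) (φ : ℝ) : Measure (ℕ → ℕ) :=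
  Measure.infinitePi fun x : ℕ => marginal lam w φ x

/-- The canonical measure `π_{Λ,N}` on the lattice of size `L`: the measure proportional to
`∏ₓ w_x(η_x) λ_x^{η_x}` on the configurations with `N` particles. -/
def canonical (lam : ℕ → ℝ) (w : ℕ → ℕ → ℝ) (L N : ℕ) : Measure (Fin L → ℕ) :=
  ProbabilityTheory.cond
    (Measure.count.withDensity fun η : Fin L → ℕ => ∏ x : Fin L, siteWeight lam w 1 x (η x))
    {η | ∑ x, η x = N}

/-- The expected occupation number `R_x(φ) = ν_φ^x(η_x)`. -/
def siteDensity (lam : ℕ → ℝ) (w : ℕ → ℕ → ℝ) (φ : ℝ) (x : ℕ) : ℝ≥0∞ :=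
  ∫⁻ n, (n : ℝ≥0∞) ∂(marginal lam w φ x)

/-- `φ` is an admissible fugacity and `(1/L) ∑_{x ∈ Λ} R_x(φ)` converges to `r` as `L → ∞`;
that is, the limiting density `R(φ)` exists and equals `r`. -/
def HasDensity (lam : ℕ → ℝ) (w : ℕ → ℕ → ℝ) (φ : ℝ) (r : ℝ≥0∞) : Prop :=
  φ ∈ fugacityDomain lam w ∧
    Tendsto (fun L : ℕ => (∑ x ∈ Finset.range L, siteDensity lam w φ x) / (L : ℝ≥0∞))
      atTop (𝓝 r)

/-- The limiting density `R(φ)` exists for all `0 ≤ φ < φ_c`, and `ρ_c ∈ [0, ∞]` is the critical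
density, the limit of `R(φ)` as `φ` increases to `φ_c`. -/
def IsCriticalDensity (lam : ℕ → ℝ) (w : ℕ → ℕ → ℝ) (ρc : ℝ≥0∞) : Prop :=
  ∃ R : ℝ → ℝ≥0∞,
    (∀ φ, 0 ≤ φ → φ < criticalFugacity lam w → HasDensity lam w φ (R φ)) ∧
      Tendsto R (𝓝[<] criticalFugacity lam w) (𝓝 ρc)

/-- A configuration on the lattice of size `L`, extended by empty sites. A cylinder function with
support in the lattice does not depend on how a configuration is extended. -/
def extendByZero {L : ℕ} (η : Fin L → ℕ) : ℕ → ℕ :=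
  fun x => if h : x < L then η ⟨x, h⟩ else 0

/-- The specific relative entropy `(1/L) H(π_{Λ,N} ; ν_φ^Λ)` tends to `0` along the sequence
of lattice sizes `L k` and particle numbers `N k`. -/
def EntropyConverges (lam : ℕ → ℝ) (w : ℕ → ℕ → ℝ) (φ : ℝ) (L N : ℕ → ℕ) : Prop :=
  Tendsto (fun k => InformationTheory.klDiv (canonical lam w (L k) (N k))
    (grandCanonical lam w φ (L k)) / (L k : ℝ≥0∞)) atTop (𝓝 0)

/-- `π_{Λ,N}(f) → ν_φ(f)` along the sequences `L k`, `N k`, for every cylinder function `f` (one that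
depends on finitely many sites) that lies in `L^{1+ε}(ν_φ)` for some `ε > 0`. -/
def CylinderConverges (lam : ℕ → ℝ) (w : ℕ → ℕ → ℝ) (φ : ℝ) (L N : ℕ → ℕ) : Prop :=
  ∀ (f : (ℕ → ℕ) → ℝ) (Δ : Finset ℕ) (ε : ℝ), DependsOn f (Δ : Set ℕ) → 0 < ε →
    MemLp f (ENNReal.ofReal (1 + ε)) (grandCanonicalInf lam w φ) →
      Tendsto (fun k => ∫ η, f (extendByZero η) ∂(canonical lam w (L k) (N k)))
        atTop (𝓝 (∫ η, f η ∂(grandCanonicalInf lam w φ)))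

end

end Condensation

open Condensation

/-! The canonical measure is `ν_φ` conditioned on `S_L = N`, where `S_L` is the number of particles
in `Λ`: on that event the factor `φ^N` and the partition functions are constants. Both claims thus
become statements about the point probabilities of a sum of independent variables near its mean
`ρL`.

The relative entropy is exactly `-log ν_φ(S_L = N)`, so a lower bound `exp(-εL)` for every `ε > 0`
suffices (`eventually_exp_le_measureReal_sum`). A small fraction of well-behaved sites is reserved.
By a weak law the other sites carry slightly fewer than `N` particles with probability at least
`1/2`, and the reserved sites supply the missing particles at a small exponential cost.

For cylinder functions on `Δ`, integrating out the sites off `Δ` weights `f` by ratios of the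
probabilities that the sites off `Δ` carry `N - m` and `N` particles. These ratios tend to `1`
(`eventually_ratio`). Moving one particle off a site shows that the expected number of singly
occupied sites on `S = n + 1` equals a weighted expected number of empty sites on `S = n`. Both
counts have the same mean, of order `L`, and are exponentially concentrated, while the conditioning
events are only subexponentially rare; hence the two events have nearly equal probability. The
ratios are also at most `(1 + ε)^m`, so Hölder and exponential moments on `Δ`, which exist when `λ_x
φ < 1`, permit dominated convergence.

`RegularFamily` records what this needs. The delicate point is uniform integrability on average at
`φ_c`, where no domination uniform in `x` need exist. It is obtained by comparison with a smaller
fugacity of nearly the same density: by stochastic monotonicity the excess of the tail is at most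
the difference of the densities (`tail_add_siteDensity_le`). -/

namespace Condensation

open ProbabilityTheory Finset

/-! ### Weak law and subexponential lower bounds for point probabilities -/

section Families

variable {Ω : Type*} [MeasurableSpace Ω] {P : Measure Ω} [IsProbabilityMeasure P]

/-- Hoeffding's inequality for at most `L` independent variables with values in `[0, M]`. -/
theorem measureReal_abs_sum_sub_ge_le {Y : ℕ → Ω → ℝ} (hY : iIndepFun Y P)
    (hm : ∀ x, Measurable (Y x)) {M : ℝ} (hM : 0 < M) (hb : ∀ x ω, Y x ω ∈ Set.Icc 0 M)
    {A : Finset ℕ} {L : ℕ} (hA : #A ≤ L) {δ : ℝ} (hδ : 0 < δ) :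
    P.real {ω | δ * L ≤ |∑ x ∈ A, Y x ω - ∑ x ∈ A, ∫ ω, Y x ω ∂P|} ≤
      2 * Real.exp (-(2 * δ ^ 2 / M ^ 2 * L)) := by
  rcases Nat.eq_zero_or_pos L with rfl | hL
  · simp only [Nat.cast_zero, mul_zero, neg_zero, Real.exp_zero, mul_one]
    exact (measureReal_le_one (μ := P)).trans one_le_two
  have hL' : (0 : ℝ) < L := by exact_mod_cast hL
  rcases A.eq_empty_or_nonempty with rfl | hne
  · have : ¬ (δ * L ≤ 0) := by have := mul_pos hδ hL'; linarith
    simp only [sum_empty, sub_self, abs_zero, this, Set.ofPred_false, measureReal_empty]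
    positivity
  have hcard : (0 : ℝ) < #A := by exact_mod_cast hne.card_pos
  have hcard' : (#A : ℝ) ≤ L := by exact_mod_cast hA
  have key : ∀ s : ℝ, s = 1 ∨ s = -1 →
      P.real {ω | δ * L ≤ ∑ x ∈ A, s * (Y x ω - ∫ ω, Y x ω ∂P)} ≤
        Real.exp (-(2 * δ ^ 2 / M ^ 2 * L)) := by
    intro s hs
    have hsub : ∀ x ∈ A, HasSubgaussianMGF (fun ω => s * (Y x ω - ∫ ω, Y x ω ∂P))
        ((‖M - 0‖₊ / 2) ^ 2) P := by
      intro x _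
      have h := hasSubgaussianMGF_of_mem_Icc (μ := P) (hm x).aemeasurable
        (Eventually.of_forall (hb x))
      rcases hs with rfl | rfl
      · simpa using h
      · have := h.neg
        convert this using 1
        ext ω
        simp
    have hind : iIndepFun (fun x ω => s * (Y x ω - ∫ ω, Y x ω ∂P)) P :=
      hY.comp (fun x y => s * (y - ∫ ω, Y x ω ∂P)) (fun x => by fun_prop)
    refine (HasSubgaussianMGF.measure_sum_ge_le_of_iIndepFun hind hsub
      (by positivity : 0 ≤ δ * L)).trans (Real.exp_le_exp.2 ?_)
    have hMM : ((‖M - 0‖₊ : NNReal) : ℝ) = M := by simp [abs_of_pos hM]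
    simp only [sum_const, nsmul_eq_mul, NNReal.coe_pow, NNReal.coe_div, NNReal.coe_ofNat, hMM,
      NNReal.coe_mul, NNReal.coe_natCast]
    rw [neg_div, neg_le_neg_iff, le_div_iff₀ (by positivity)]
    calc 2 * δ ^ 2 / M ^ 2 * L * (2 * (#A * (M / 2) ^ 2)) = δ ^ 2 * L * #A := by
          field_simp
      _ ≤ δ ^ 2 * L * L := by gcongr
      _ = (δ * L) ^ 2 := by ring
  have h1 := key 1 (Or.inl rfl)
  have h2 := key (-1) (Or.inr rfl)
  calc _ ≤ P.real ({ω | δ * L ≤ ∑ x ∈ A, (1 : ℝ) * (Y x ω - ∫ ω, Y x ω ∂P)} ∪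
        {ω | δ * L ≤ ∑ x ∈ A, (-1 : ℝ) * (Y x ω - ∫ ω, Y x ω ∂P)}) := by
        refine measureReal_mono fun ω hω => ?_
        simp only [Set.mem_ofPred_eq, Set.mem_union, ← mul_sum, sum_sub_distrib] at hω ⊢
        rcases le_abs.1 hω with h | h
        · left; linarith
        · right; linarith
    _ ≤ _ := (measureReal_union_le _ _).trans (by linarith)

/-- Independent `ℕ`-valued variables with Cesàro mean tending to `ρ`, which are uniformly
integrable on average and of which a positive fraction has uniformly controlled laws. -/
structure RegularFamily (P : Measure Ω) (X : ℕ → Ω → ℕ) (ρ : ℝ) : Prop where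
  meas : ∀ x, Measurable (X x)
  indep : iIndepFun X P
  integrable : ∀ x, Integrable (fun ω => (X x ω : ℝ)) P
  density : Tendsto (fun L : ℕ => (∑ x ∈ range L, ∫ ω, (X x ω : ℝ) ∂P) / L) atTop (𝓝 ρ)
  tail : ∀ ε > 0, ∃ K : ℕ, ∀ᶠ L : ℕ in atTop,
    ∑ x ∈ range L, ∫ ω, ((X x ω - K : ℕ) : ℝ) ∂P ≤ ε * L
  good : ∃ γ : ℝ, 0 < γ ∧ ∃ (a : ℝ) (c : ℕ → ℝ), (∀ n, 0 < c n) ∧ ∀ᶠ L : ℕ in atTop, ∃ G ⊆ range L,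
    γ * L ≤ #G ∧ ∀ x ∈ G, ∫ ω, (X x ω : ℝ) ∂P ≤ a ∧ ∀ n, c n ≤ P.real {ω | X x ω = n}
  ratio : ∃ (r : ℕ → ℝ) (M : ℝ), ∀ x, 0 ≤ r x ∧ r x ≤ M ∧
    P.real {ω | X x ω = 1} = r x * P.real {ω | X x ω = 0}

namespace RegularFamily

variable {X : ℕ → Ω → ℕ} {ρ : ℝ}

/-- Truncation at `K`: Hoeffding controls the part `min X K`, Markov the excess `X - K`, so no
second moment enters. Both bounds see `A` only through `A ⊆ range L`, which makes the estimate
uniform in `A`. -/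
theorem weak_law (h : RegularFamily P X ρ) {δ : ℝ} (hδ : 0 < δ) :
    ∀ᶠ L : ℕ in atTop, ∀ A ⊆ range L,
      P.real {ω | δ * L < |∑ x ∈ A, (X x ω : ℝ) - ∑ x ∈ A, ∫ ω, (X x ω : ℝ) ∂P|} ≤ 1 / 2 := by
  -- Markov at level `δ/4 · L` then costs probability `1/4`, and `δ/2 + δ/4 + δ/16 < δ`.
  obtain ⟨K, hK⟩ := h.tail (δ / 16) (by positivity)
  have hexp : Tendsto (fun L : ℕ =>
      2 * Real.exp (-(2 * (δ / 2) ^ 2 / ((K : ℝ) + 1) ^ 2 * L))) atTop (𝓝 (2 * 0)) := by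
    refine (Real.tendsto_exp_neg_atTop_nhds_zero.comp ?_).const_mul 2
    exact tendsto_natCast_atTop_atTop.const_mul_atTop (by positivity)
  rw [mul_zero] at hexp
  filter_upwards [hK, hexp.eventually_lt_const (by norm_num : (0 : ℝ) < 1 / 4),
    eventually_gt_atTop 0] with L hL hexpL hL0 A hA
  have hL' : (0 : ℝ) < L := by exact_mod_cast hL0
  have hcard : #A ≤ L := by simpa using card_le_card hA
  set Y : ℕ → Ω → ℝ := fun x ω => ((min (X x ω) K : ℕ) : ℝ) with hYdef
  set T : ℕ → Ω → ℝ := fun x ω => ((X x ω - K : ℕ) : ℝ) with hTdef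
  have hXYT : ∀ x ω, (X x ω : ℝ) = Y x ω + T x ω := by
    intro x ω
    simp only [hYdef, hTdef]
    exact_mod_cast (by omega : X x ω = min (X x ω) K + (X x ω - K))
  have hYm : ∀ x, Measurable (Y x) := fun x =>
    (Measurable.of_discrete (f := fun n : ℕ => ((min n K : ℕ) : ℝ))).comp (h.meas x)
  have hTm : ∀ x, Measurable (T x) := fun x =>
    (Measurable.of_discrete (f := fun n : ℕ => ((n - K : ℕ) : ℝ))).comp (h.meas x)
  have hTint : ∀ x, Integrable (T x) P := fun x =>
    (h.integrable x).mono (hTm x).aestronglyMeasurable (Eventually.of_forall fun ω => by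
      simp only [hTdef, Real.norm_natCast]
      exact_mod_cast Nat.sub_le _ _)
  have hYint : ∀ x, Integrable (Y x) P := fun x =>
    (h.integrable x).mono (hYm x).aestronglyMeasurable (Eventually.of_forall fun ω => by
      simp only [hYdef, Real.norm_natCast]
      exact_mod_cast min_le_left _ _)
  have hT0 : ∀ x ω, 0 ≤ T x ω := fun x ω => Nat.cast_nonneg _
  have hYind : iIndepFun Y P :=
    h.indep.comp (fun _ n => ((min n K : ℕ) : ℝ)) (fun _ => Measurable.of_discrete)
  have hho := measureReal_abs_sum_sub_ge_le hYind hYm (M := (K : ℝ) + 1) (by positivity)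
    (fun x ω => ⟨Nat.cast_nonneg _, by
      simp only [hYdef]
      have : ((min (X x ω) K : ℕ) : ℝ) ≤ K := by exact_mod_cast min_le_right _ _
      linarith⟩) hcard (half_pos hδ)
  have hET : ∑ x ∈ A, ∫ ω, T x ω ∂P ≤ δ / 16 * L :=
    (sum_le_sum_of_subset_of_nonneg hA fun x _ _ => integral_nonneg (hT0 x)).trans hL
  have hET0 : 0 ≤ ∑ x ∈ A, ∫ ω, T x ω ∂P := sum_nonneg fun x _ => integral_nonneg (hT0 x)
  have hmarkov : P.real {ω | δ / 4 * L ≤ ∑ x ∈ A, T x ω} ≤ 1 / 4 := by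
    have := mul_meas_ge_le_integral_of_nonneg (μ := P)
      (Eventually.of_forall fun ω => sum_nonneg fun x _ => hT0 x ω)
      (integrable_finsetSum A fun x _ => hTint x) (δ / 4 * L)
    rw [integral_finsetSum _ fun x _ => hTint x] at this
    have h4 : 0 < δ / 4 * L := by positivity
    rw [← mul_le_mul_iff_right₀ h4]
    linarith
  calc _ ≤ P.real ({ω | δ / 2 * L ≤ |∑ x ∈ A, Y x ω - ∑ x ∈ A, ∫ ω, Y x ω ∂P|} ∪
        {ω | δ / 4 * L ≤ ∑ x ∈ A, T x ω}) := by
        refine measureReal_mono fun ω hω => ?_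
        by_contra hcon
        simp only [Set.mem_union, Set.mem_ofPred_eq, not_or, not_le] at hcon hω
        obtain ⟨h1, h2⟩ := hcon
        have e1 : ∑ x ∈ A, (X x ω : ℝ) = ∑ x ∈ A, Y x ω + ∑ x ∈ A, T x ω := by
          rw [← sum_add_distrib]; exact sum_congr rfl fun x _ => hXYT x ω
        have e2 : ∑ x ∈ A, ∫ ω, (X x ω : ℝ) ∂P =
            ∑ x ∈ A, ∫ ω, Y x ω ∂P + ∑ x ∈ A, ∫ ω, T x ω ∂P := by
          rw [← sum_add_distrib]
          refine sum_congr rfl fun x _ => ?_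
          rw [← integral_add (hYint x) (hTint x)]
          exact integral_congr_ae (Eventually.of_forall fun ω => hXYT x ω)
        have h3 : 0 ≤ ∑ x ∈ A, T x ω := sum_nonneg fun x _ => hT0 x ω
        have := mul_pos hδ hL'
        rw [abs_lt] at h1
        rw [e1, e2, lt_abs] at hω
        rcases hω with h' | h' <;> linarith
    _ ≤ _ := (measureReal_union_le _ _).trans (by linarith)

omit [IsProbabilityMeasure P] in
theorem measurable_sum (h : RegularFamily P X ρ) (A : Finset ℕ) :
    Measurable fun ω => ∑ x ∈ A, X x ω :=
  Finset.measurable_fun_sum A fun x _ => h.meas x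

omit [IsProbabilityMeasure P] in
theorem indepFun_sum (h : RegularFamily P X ρ) {A B : Finset ℕ} (hAB : Disjoint A B) :
    IndepFun (fun ω => ∑ x ∈ A, X x ω) (fun ω => ∑ x ∈ B, X x ω) P := by
  have := (h.indep.indepFun_finset A B hAB h.meas).comp
    (φ := fun u : A → ℕ => ∑ x, u x) (ψ := fun u : B → ℕ => ∑ x, u x)
    (by fun_prop) (by fun_prop)
  convert this using 1 <;> ext ω <;>
    simp [Finset.sum_attach _ fun x => X x ω]

omit [IsProbabilityMeasure P] in
theorem measureReal_sum_inter (h : RegularFamily P X ρ) {A B : Finset ℕ} (hAB : Disjoint A B)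
    (m n : ℕ) :
    P.real ({ω | ∑ x ∈ A, X x ω = m} ∩ {ω | ∑ x ∈ B, X x ω = n}) =
      P.real {ω | ∑ x ∈ A, X x ω = m} * P.real {ω | ∑ x ∈ B, X x ω = n} := by
  have := (h.indepFun_sum hAB).measure_inter_preimage_eq_mul {m} {n} (measurableSet_singleton m)
    (measurableSet_singleton n)
  simpa [measureReal_def, Set.preimage] using congrArg ENNReal.toReal this

/-- One explicit configuration suffices: fill the sites greedily, each with `min m K` of the
particles still to be placed. -/
theorem pow_card_le_measureReal_sum_eq (h : RegularFamily P X ρ) {c : ℝ} (hc : 0 ≤ c)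
    {K : ℕ} (B : Finset ℕ) (hB : ∀ x ∈ B, ∀ n ≤ K, c ≤ P.real {ω | X x ω = n}) (m : ℕ) (hm : m ≤ K * #B) :
    c ^ #B ≤ P.real {ω | ∑ x ∈ B, X x ω = m} := by
  induction B using Finset.induction_on generalizing m with
  | empty =>
    obtain rfl : m = 0 := by simpa using hm
    simp
  | insert y B hy ih =>
    rw [card_insert_of_notMem hy] at hm ⊢
    have h1 := ih (fun x hx => hB x (mem_insert_of_mem hx)) (m - min m K) (by
      rw [mul_add] at hm; omega)
    have h2 := hB y (mem_insert_self y B) (min m K) (min_le_right _ _)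
    have h3 := h.measureReal_sum_inter (disjoint_singleton_left.2 hy) (min m K) (m - min m K)
    simp only [sum_singleton] at h3
    rw [pow_succ']
    calc _ ≤ _ := mul_le_mul h2 h1 (by positivity) measureReal_nonneg
      _ = _ := h3.symm
      _ ≤ _ := measureReal_mono fun ω hω => by
        simp only [Set.mem_inter_iff, Set.mem_ofPred_eq, sum_insert hy] at hω ⊢
        omega

/-- Whatever `A` carries, if the deficit is at most `M` then the independent block `B` makes it up
with probability at least `c`. -/
theorem mul_le_measureReal_sum_union (h : RegularFamily P X ρ) {A B : Finset ℕ}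
    (hAB : Disjoint A B) {c : ℝ} {M n : ℕ}
    (hB : ∀ m ≤ M, c ≤ P.real {ω | ∑ x ∈ B, X x ω = m}) :
    P.real {ω | ∑ x ∈ A, X x ω ≤ n ∧ n ≤ ∑ x ∈ A, X x ω + M} * c ≤
      P.real {ω | ∑ x ∈ A ∪ B, X x ω = n} := by
  have hmeas : ∀ (A : Finset ℕ) m, MeasurableSet {ω | ∑ x ∈ A, X x ω = m} := fun A m =>
    h.measurable_sum A (measurableSet_singleton m)
  have e1 : {ω | ∑ x ∈ A, X x ω ≤ n ∧ n ≤ ∑ x ∈ A, X x ω + M} =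
      ⋃ m ∈ Icc (n - M) n, {ω | ∑ x ∈ A, X x ω = m} := by
    ext ω
    simp only [Set.mem_ofPred_eq, Set.mem_iUnion, Finset.mem_Icc, exists_prop]
    constructor
    · intro hω; exact ⟨_, by omega, rfl⟩
    · rintro ⟨m, hm, hω⟩; omega
  rw [e1, measureReal_biUnion_finset (fun i _ j _ hij => Set.disjoint_left.2 fun ω hi hj =>
    hij (hi.symm.trans hj)) fun m _ => hmeas A m, sum_mul]
  calc _ ≤ ∑ m ∈ Icc (n - M) n,
        P.real ({ω | ∑ x ∈ A, X x ω = m} ∩ {ω | ∑ x ∈ B, X x ω = n - m}) := by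
        refine sum_le_sum fun m hm => ?_
        rw [h.measureReal_sum_inter hAB]
        rw [Finset.mem_Icc] at hm
        exact mul_le_mul_of_nonneg_left (hB _ (by omega)) measureReal_nonneg
    _ = P.real (⋃ m ∈ Icc (n - M) n,
        ({ω | ∑ x ∈ A, X x ω = m} ∩ {ω | ∑ x ∈ B, X x ω = n - m})) :=
        (measureReal_biUnion_finset (fun i _ j _ hij => Set.disjoint_left.2 fun ω hi hj =>
          hij (hi.1.symm.trans hj.1)) fun m _ => (hmeas A m).inter (hmeas B _)).symm
    _ ≤ _ := measureReal_mono fun ω hω => by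
        simp only [Set.mem_iUnion, Finset.mem_Icc, Set.mem_inter_iff, Set.mem_ofPred_eq,
          exists_prop] at hω
        obtain ⟨m, hm, h1, h2⟩ := hω
        simp only [Set.mem_ofPred_eq, sum_union hAB]
        omega

theorem eventually_exp_le_measureReal_sum (h : RegularFamily P X ρ) (Δ : Finset ℕ) {ε : ℝ}
    (hε : 0 < ε) :
    ∃ δ > 0, ∀ᶠ L : ℕ in atTop, ∀ n : ℕ, |(n : ℝ) - ρ * L| ≤ δ * L →
      Real.exp (-(ε * L)) ≤ P.real {ω | ∑ x ∈ range L \ Δ, X x ω = n} := by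
  obtain ⟨γ, hγ, a, c, hc, hG⟩ := h.good
  -- A block of `b` good sites has mean at most `a * b` but can hold `K * b`, which leaves an upward
  -- slack of `b`.
  obtain ⟨K, hK⟩ : ∃ K : ℕ, a + 1 ≤ K := exists_nat_ge _
  obtain ⟨c₀, hc₀, hc₀1, hc₀c⟩ : ∃ c₀ : ℝ, 0 < c₀ ∧ c₀ ≤ 1 ∧ ∀ n ≤ K, c₀ ≤ c n := by
    obtain ⟨i, hi, hmin⟩ := exists_min_image (range (K + 1)) c ⟨0, by simp⟩
    exact ⟨min (c i) 1, lt_min (hc i) one_pos, min_le_right _ _, fun n hn =>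
      (min_le_left _ _).trans (hmin n (by simpa using Nat.lt_succ_of_le hn))⟩
  set ℓ := -Real.log c₀ with hℓ
  have hℓ0 : 0 ≤ ℓ := by simpa [hℓ] using Real.log_nonpos hc₀.le hc₀1
  -- `β` is the density of reserved sites: `γ / 2` leaves room for deleting `Δ`, and `β * ℓ ≤ ε / 2`
  -- keeps the cost `c₀ ^ b` above `exp(-εL/2)`.
  obtain ⟨β, hβ, hβγ, hβε⟩ : ∃ β : ℝ, 0 < β ∧ β ≤ γ / 2 ∧ β * ℓ ≤ ε / 2 := by
    refine ⟨min (γ / 2) (ε / (2 * (ℓ + 1))), by positivity, min_le_left _ _, ?_⟩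
    calc _ ≤ ε / (2 * (ℓ + 1)) * ℓ := by gcongr; exact min_le_right _ _
      _ ≤ ε / 2 := by
        rw [div_mul_eq_mul_div, div_le_div_iff₀ (by positivity) (by positivity)]
        nlinarith
  set κ := min (c 1) 1 with hκ
  have hκ0 : 0 < κ := lt_min (hc 1) one_pos
  -- The errors (in `n`, in the mean, from `Δ`, and the fluctuation) total at most `3δL`. Removing
  -- the block lowers the mean by at least `κ * b ≥ 3δL`, and the upward slack `b` is also at least
  -- `3δL`.
  set δ := κ * β / 6 with hδ
  have hδ0 : 0 < δ := by positivity
  have hδκ : 6 * δ ≤ κ * β := by rw [hδ]; linarith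
  have hδβ : 6 * δ ≤ β := by
    have : κ * β ≤ 1 * β := by gcongr; exact min_le_right _ _
    linarith
  refine ⟨δ, hδ0, ?_⟩
  have hdens : ∀ᶠ L : ℕ in atTop,
      |∑ x ∈ range L, ∫ ω, (X x ω : ℝ) ∂P - ρ * L| ≤ δ / 2 * L := by
    filter_upwards [h.density.eventually (Metric.ball_mem_nhds ρ (half_pos hδ0)),
      eventually_gt_atTop 0] with L hL hL0
    have hL' : (0 : ℝ) < L := by exact_mod_cast hL0
    rw [Real.dist_eq] at hL
    rw [← div_le_iff₀ hL', ← abs_of_pos hL', ← abs_div, sub_div, abs_of_pos hL',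
      mul_div_cancel_right₀ _ hL'.ne']
    exact hL.le
  have hlin : ∀ b c : ℝ, 0 < c → ∀ᶠ L : ℕ in atTop, b ≤ c * L := fun b c hc =>
    (tendsto_natCast_atTop_atTop.const_mul_atTop hc).eventually_ge_atTop b
  filter_upwards [hG, h.weak_law hδ0, hdens, hlin (#Δ) (γ / 2) (by positivity),
    hlin 2 β hβ, hlin (∑ x ∈ Δ, ∫ ω, (X x ω : ℝ) ∂P) (δ / 2) (by positivity),
    hlin (Real.log 4) (ε / 2) (by positivity)]
    with L ⟨G, hGL, hGcard, hGx⟩ hwl hd hΔ hβL hEΔ hlog n hn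
  set b := ⌊β * L⌋₊ with hb
  have hbl : (b : ℝ) ≤ β * L := Nat.floor_le (by positivity)
  have hbg : β * L / 2 ≤ b := by have := Nat.lt_floor_add_one (β * L); linarith
  obtain ⟨B, hBG, hBcard⟩ : ∃ B ⊆ G \ Δ, #B = b := by
    apply exists_subset_card_eq
    have h1 : #G ≤ #(G \ Δ) + #Δ := by
      have := card_le_card_sdiff_add_card (s := G) (t := Δ); omega
    have h2 : (#G : ℝ) ≤ #(G \ Δ) + #Δ := by exact_mod_cast h1
    have h3 : (b : ℝ) ≤ #(G \ Δ) := by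
      have : β * L ≤ γ / 2 * L := by gcongr
      linarith
    exact_mod_cast h3
  have hBA : B ⊆ range L \ Δ := fun x hx => by
    have := mem_sdiff.1 (hBG hx); exact mem_sdiff.2 ⟨hGL this.1, this.2⟩
  set A := (range L \ Δ) \ B with hA
  have hAB : Disjoint A B := sdiff_disjoint
  have hE0 : ∀ x, 0 ≤ ∫ ω, (X x ω : ℝ) ∂P := fun x => integral_nonneg fun ω => Nat.cast_nonneg _
  have hEB1 : ∑ x ∈ B, ∫ ω, (X x ω : ℝ) ∂P ≤ a * b := by
    rw [← hBcard, mul_comm, ← nsmul_eq_mul]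
    exact sum_le_card_nsmul _ _ _ fun x hx => (hGx x (mem_sdiff.1 (hBG hx)).1).1
  have hEB2 : κ * b ≤ ∑ x ∈ B, ∫ ω, (X x ω : ℝ) ∂P := by
    rw [← hBcard, mul_comm, ← nsmul_eq_mul]
    refine card_nsmul_le_sum _ _ _ fun x hx => ?_
    have h1 := (hGx x (mem_sdiff.1 (hBG hx)).1).2 1
    have h2 := mul_meas_ge_le_integral_of_nonneg (μ := P)
      (Eventually.of_forall fun ω => Nat.cast_nonneg (X x ω)) (h.integrable x) 1
    have h3 : P.real {ω | X x ω = 1} ≤ P.real {ω | (1 : ℝ) ≤ X x ω} :=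
      measureReal_mono fun ω hω => by
        simp only [Set.mem_ofPred_eq] at hω ⊢; simp [hω]
    have h4 : κ ≤ c 1 := min_le_left _ _
    linarith
  have hEsum : ∑ x ∈ A, ∫ ω, (X x ω : ℝ) ∂P + ∑ x ∈ B, ∫ ω, (X x ω : ℝ) ∂P +
      ∑ x ∈ range L ∩ Δ, ∫ ω, (X x ω : ℝ) ∂P = ∑ x ∈ range L, ∫ ω, (X x ω : ℝ) ∂P := by
    rw [hA, sum_sdiff hBA, add_comm, sum_inter_add_sum_sdiff]
  have hEΔ' : ∑ x ∈ range L ∩ Δ, ∫ ω, (X x ω : ℝ) ∂P ≤ δ / 2 * L :=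
    (sum_le_sum_of_subset_of_nonneg inter_subset_right fun x _ _ => hE0 x).trans hEΔ
  have hEΔ0 : 0 ≤ ∑ x ∈ range L ∩ Δ, ∫ ω, (X x ω : ℝ) ∂P := sum_nonneg fun x _ => hE0 x
  have hAU : A ∪ B = range L \ Δ := by rw [hA, sdiff_union_of_subset hBA]
  have hpow := h.pow_card_le_measureReal_sum_eq hc₀.le (K := K) B fun x hx n hn =>
    (hc₀c n hn).trans ((hGx x (mem_sdiff.1 (hBG hx)).1).2 n)
  have hmain := h.mul_le_measureReal_sum_union hAB (n := n) hpow
  rw [hAU, hBcard] at hmain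
  refine le_trans ?_ hmain
  have hhalf : 1 / 2 ≤
      P.real {ω | ∑ x ∈ A, X x ω ≤ n ∧ n ≤ ∑ x ∈ A, X x ω + K * b} := by
    have h1 := hwl A ((sdiff_subset).trans sdiff_subset)
    have h2 : (1 : ℝ) ≤ P.real {ω | δ * L < |∑ x ∈ A, (X x ω : ℝ) -
        ∑ x ∈ A, ∫ ω, (X x ω : ℝ) ∂P|} +
        P.real {ω | ∑ x ∈ A, X x ω ≤ n ∧ n ≤ ∑ x ∈ A, X x ω + K * b} := by
      refine le_trans ?_ (measureReal_union_le _ _)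
      rw [← probReal_univ (μ := P)]
      refine measureReal_mono fun ω _ => ?_
      simp only [Set.mem_union, Set.mem_ofPred_eq]
      by_contra! hcon
      obtain ⟨hc1, hc2⟩ := hcon
      rw [abs_le] at hc1 hn hd
      have h5 : ((∑ x ∈ A, X x ω : ℕ) : ℝ) ≤ n := by
        push_cast
        have : κ * (β * L / 2) ≤ κ * b := by gcongr
        have : 6 * δ * L ≤ κ * β * L := by gcongr
        nlinarith
      have h6 : (n : ℝ) ≤ ((∑ x ∈ A, X x ω + K * b : ℕ) : ℝ) := by
        push_cast
        have : (a + 1) * b ≤ K * b := by gcongr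
        have : 6 * δ * L ≤ β * L := by gcongr
        nlinarith
      exact absurd (hc2 (by exact_mod_cast h5)) (not_lt.2 (by exact_mod_cast h6))
    linarith
  calc Real.exp (-(ε * L)) ≤ 1 / 2 * c₀ ^ b := by
        have e1 : (1 / 2 : ℝ) * c₀ ^ b = Real.exp (-(Real.log 2) - b * ℓ) := by
          rw [hℓ, mul_neg, sub_neg_eq_add, Real.exp_add, Real.exp_neg, Real.exp_log two_pos,
            Real.exp_nat_mul, Real.exp_log hc₀]
          ring
        rw [e1, Real.exp_le_exp]
        have : (b : ℝ) * ℓ ≤ ε / 2 * L := by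
          calc (b : ℝ) * ℓ ≤ β * L * ℓ := by gcongr
            _ = β * ℓ * L := by ring
            _ ≤ ε / 2 * L := by gcongr
        have : Real.log 2 ≤ Real.log 4 := Real.log_le_log two_pos (by norm_num)
        linarith
    _ ≤ _ := by gcongr

end RegularFamily

end Families

/-! ### Neighbouring point probabilities have ratio tending to one -/

section Ratio

variable {Ω : Type*} [MeasurableSpace Ω] {P : Measure Ω} [IsProbabilityMeasure P]

/-- On events that are not exponentially unlikely, sums of independent bounded variables have
conditional mean close to their unconditional mean. -/
theorem eventually_abs_setIntegral_sum_sub_le {Y : ℕ → Ω → ℝ} (hY : iIndepFun Y P)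
    (hm : ∀ x, Measurable (Y x)) {M : ℝ} (hM : 0 < M) (hb : ∀ x ω, Y x ω ∈ Set.Icc 0 M)
    {δ : ℝ} (hδ : 0 < δ) :
    ∃ ε > 0, ∀ᶠ L : ℕ in atTop, ∀ A ⊆ range L, ∀ E : Set Ω,
      Real.exp (-(ε * L)) ≤ P.real E →
        |∫ ω in E, ∑ x ∈ A, Y x ω ∂P - (∑ x ∈ A, ∫ ω, Y x ω ∂P) * P.real E| ≤
          δ * L * P.real E := by
  -- Half the Hoeffding exponent: of the bound `2 exp(-2εL)`, one factor `exp(-εL)` is absorbed by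
  -- `P.real E` and the other by the constant `2M`.
  set ε := (δ / 2) ^ 2 / M ^ 2 with hε
  have hε0 : 0 < ε := by positivity
  refine ⟨ε, hε0, ?_⟩
  have hexp : Tendsto (fun L : ℕ => 2 * M * Real.exp (-(ε * L))) atTop (𝓝 (2 * M * 0)) := by
    refine (Real.tendsto_exp_neg_atTop_nhds_zero.comp ?_).const_mul _
    exact tendsto_natCast_atTop_atTop.const_mul_atTop hε0
  rw [mul_zero] at hexp
  filter_upwards [hexp.eventually_lt_const (half_pos hδ)] with L hL A hA E hPE
  have hcard : #A ≤ L := by simpa using card_le_card hA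
  have hint : ∀ x, Integrable (Y x) P := fun x =>
    Integrable.of_mem_Icc 0 M (hm x).aemeasurable (Eventually.of_forall (hb x))
  set m := ∑ x ∈ A, ∫ ω, Y x ω ∂P with hmdef
  set bad := {ω | δ / 2 * L ≤ |∑ x ∈ A, Y x ω - m|} with hbad
  have hbadm : MeasurableSet bad := by
    refine measurableSet_le measurable_const ?_
    exact ((Finset.measurable_fun_sum A fun x _ => hm x).sub_const m).abs
  have hho : P.real bad ≤ _ := measureReal_abs_sum_sub_ge_le hY hm hM hb hcard (half_pos hδ)
  have hmL : 0 ≤ m ∧ m ≤ M * L := by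
    constructor
    · exact sum_nonneg fun x _ => integral_nonneg fun ω => (hb x ω).1
    · calc m ≤ ∑ x ∈ A, M := sum_le_sum fun x _ => by
            simpa using integral_mono (hint x) (integrable_const M) fun ω => (hb x ω).2
        _ = #A * M := by simp
        _ ≤ M * L := by rw [mul_comm]; gcongr
  have hsL : ∀ ω, 0 ≤ ∑ x ∈ A, Y x ω ∧ ∑ x ∈ A, Y x ω ≤ M * L := fun ω => by
    constructor
    · exact sum_nonneg fun x _ => (hb x ω).1
    · calc _ ≤ ∑ x ∈ A, M := sum_le_sum fun x _ => (hb x ω).2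
        _ = #A * M := by simp
        _ ≤ M * L := by rw [mul_comm]; gcongr
  have hSint : Integrable (fun ω => ∑ x ∈ A, Y x ω) P := integrable_finsetSum A fun x _ => hint x
  have hpt : ∀ ω, |∑ x ∈ A, Y x ω - m| ≤ δ / 2 * L + bad.indicator (fun _ => M * L) ω := by
    intro ω
    by_cases hω : ω ∈ bad
    · rw [Set.indicator_of_mem hω, abs_le]
      have : 0 ≤ δ / 2 * L := by positivity
      constructor <;> linarith [hsL ω, hmL.1, hmL.2, (hsL ω).1, (hsL ω).2]
    · rw [Set.indicator_of_notMem hω, add_zero]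
      simp only [hbad, Set.mem_ofPred_eq, not_le] at hω
      exact hω.le
  have hindint : Integrable (bad.indicator fun _ => M * (L : ℝ)) P :=
    (integrable_const _).indicator hbadm
  have e1 : ∫ ω in E, ∑ x ∈ A, Y x ω ∂P - m * P.real E = ∫ ω in E, (∑ x ∈ A, Y x ω - m) ∂P := by
    rw [integral_sub hSint.integrableOn (integrable_const _)]
    simp [mul_comm]
  rw [e1]
  calc |∫ ω in E, (∑ x ∈ A, Y x ω - m) ∂P|
      ≤ ∫ ω in E, |∑ x ∈ A, Y x ω - m| ∂P := abs_integral_le_integral_abs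
    _ ≤ ∫ ω in E, (δ / 2 * L + bad.indicator (fun _ => M * L) ω) ∂P :=
        integral_mono (hSint.sub (integrable_const _)).integrableOn.abs
          ((integrable_const _).add hindint).integrableOn hpt
    _ = δ / 2 * L * P.real E + ∫ ω in E, bad.indicator (fun _ => M * (L : ℝ)) ω ∂P := by
        rw [integral_add (integrable_const _) hindint.integrableOn]
        simp [mul_comm]
    _ ≤ δ / 2 * L * P.real E + M * L * P.real bad := by
        gcongr
        calc _ ≤ ∫ ω, bad.indicator (fun _ => M * (L : ℝ)) ω ∂P :=
              setIntegral_le_integral hindint (Eventually.of_forall fun ω =>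
                Set.indicator_nonneg (fun _ _ => by positivity) ω)
          _ = _ := by rw [integral_indicator_const _ hbadm]; simp [mul_comm]
    _ ≤ δ / 2 * L * P.real E + M * L * (2 * Real.exp (-(2 * ε * L))) := by
        gcongr
        refine hho.trans (le_of_eq ?_)
        rw [hε]; ring_nf
    _ = δ / 2 * L * P.real E + L * (2 * M * Real.exp (-(ε * L))) * Real.exp (-(ε * L)) := by
        have : Real.exp (-(2 * ε * L)) = Real.exp (-(ε * L)) * Real.exp (-(ε * L)) := by
          rw [← Real.exp_add]; ring_nf
        rw [this]; ring
    _ ≤ δ / 2 * L * P.real E + L * (δ / 2) * P.real E := by gcongr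
    _ = _ := by ring

namespace RegularFamily

variable {X : ℕ → Ω → ℕ} {ρ : ℝ}

-- Removing the single particle at `x` lowers the total by one and leaves the other sites untouched;
-- independence turns this into a factor `r x`.
omit [IsProbabilityMeasure P] in
theorem exchange (h : RegularFamily P X ρ) {r : ℕ → ℝ}
    (hr : ∀ x, P.real {ω | X x ω = 1} = r x * P.real {ω | X x ω = 0}) {A : Finset ℕ} {x : ℕ}
    (hx : x ∈ A) (n : ℕ) :
    P.real ({ω | X x ω = 1} ∩ {ω | ∑ y ∈ A, X y ω = n + 1}) =
      r x * P.real ({ω | X x ω = 0} ∩ {ω | ∑ y ∈ A, X y ω = n}) := by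
  have hd : Disjoint {x} (A.erase x) := by simp
  have e : ∀ i j : ℕ, {ω | X x ω = i} ∩ {ω | ∑ y ∈ A, X y ω = j + i} =
      {ω | ∑ y ∈ {x}, X y ω = i} ∩ {ω | ∑ y ∈ A.erase x, X y ω = j} := by
    intro i j
    ext ω
    simp only [Set.mem_inter_iff, Set.mem_ofPred_eq, sum_singleton, ← add_sum_erase A _ hx]
    omega
  have e0 := e 0 n
  rw [add_zero] at e0
  rw [e 1 n, e0, h.measureReal_sum_inter hd, h.measureReal_sum_inter hd]
  simp only [sum_singleton, hr x]
  ring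

/-- Summing `exchange` over `x` gives one number that lies within `ηm` times the respective
probability of both `m * q1` and `m * q0`, since `∑ U` and `∑ V` have the same mean `m` and
concentrate. -/
theorem eventually_ratio (h : RegularFamily P X ρ) (Δ : Finset ℕ) {ε : ℝ} (hε : 0 < ε) :
    ∃ δ > 0, ∀ᶠ L : ℕ in atTop, ∀ n : ℕ, |(n : ℝ) - ρ * L| ≤ δ * L →
      P.real {ω | ∑ x ∈ range L \ Δ, X x ω = n} ≤
          (1 + ε) * P.real {ω | ∑ x ∈ range L \ Δ, X x ω = n + 1} ∧
        P.real {ω | ∑ x ∈ range L \ Δ, X x ω = n + 1} ≤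
          (1 + ε) * P.real {ω | ∑ x ∈ range L \ Δ, X x ω = n} := by
  obtain ⟨r, M, hr⟩ := h.ratio
  obtain ⟨γ, hγ, a, c, hc, hG⟩ := h.good
  set U : ℕ → Ω → ℝ := fun x ω => if X x ω = 1 then 1 else 0 with hU
  set V : ℕ → Ω → ℝ := fun x ω => if X x ω = 0 then r x else 0 with hV
  have hUm : ∀ x, Measurable (U x) := fun x =>
    (Measurable.of_discrete (f := fun n : ℕ => if n = 1 then (1 : ℝ) else 0)).comp (h.meas x)
  have hVm : ∀ x, Measurable (V x) := fun x =>
    (Measurable.of_discrete (f := fun n : ℕ => if n = 0 then r x else 0)).comp (h.meas x)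
  have hUi : iIndepFun U P :=
    h.indep.comp (fun _ n => if n = 1 then (1 : ℝ) else 0) (fun _ => Measurable.of_discrete)
  have hVi : iIndepFun V P :=
    h.indep.comp (fun x n => if n = 0 then r x else 0) (fun _ => Measurable.of_discrete)
  set M' := max M 1 with hM'
  have hM'0 : 0 < M' := lt_max_of_lt_right one_pos
  have hUb : ∀ x ω, U x ω ∈ Set.Icc 0 M' := fun x ω => by
    simp only [hU]; split_ifs
    · exact ⟨zero_le_one, le_max_right _ _⟩
    · exact ⟨le_rfl, hM'0.le⟩
  have hVb : ∀ x ω, V x ω ∈ Set.Icc 0 M' := fun x ω => by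
    simp only [hV]; split_ifs
    · exact ⟨(hr x).1, (hr x).2.1.trans (le_max_left _ _)⟩
    · exact ⟨le_rfl, hM'0.le⟩
  have hmeas : ∀ x i, MeasurableSet {ω | X x ω = i} := fun x i =>
    h.meas x (measurableSet_singleton i)
  have hUind : ∀ x, U x = {ω | X x ω = 1}.indicator fun _ => (1 : ℝ) := fun x => by
    ext ω; simp [hU, Set.indicator_apply]
  have hVind : ∀ x, V x = {ω | X x ω = 0}.indicator fun _ => r x := fun x => by
    ext ω; simp [hV, Set.indicator_apply]
  have hUint : ∀ x, Integrable (U x) P := fun x => by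
    rw [hUind]; exact (integrable_const _).indicator (hmeas x 1)
  have hVint : ∀ x, Integrable (V x) P := fun x => by
    rw [hVind]; exact (integrable_const _).indicator (hmeas x 0)
  have hEU : ∀ x, ∫ ω, U x ω ∂P = P.real {ω | X x ω = 1} := fun x => by
    rw [hUind, integral_indicator_const _ (hmeas x 1)]; simp
  have hEV : ∀ x, ∫ ω, V x ω ∂P = P.real {ω | X x ω = 1} := fun x => by
    rw [hVind, integral_indicator_const _ (hmeas x 0), (hr x).2.2]; simp [mul_comm]
  -- The solution of `(1 + η) / (1 - η) = 1 + ε`.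
  set η := ε / (2 + ε) with hη
  have hη0 : 0 < η := by positivity
  have hη1 : (1 + η) = (1 + ε) * (1 - η) := by rw [hη]; field_simp; ring
  have hη2 : η < 1 := by rw [hη, div_lt_one (by positivity)]; linarith
  -- The good sites off `Δ` give `m ≥ c 1 * (γ / 2) * L`, so this concentration error is at most `η
  -- * m`.
  have hδ' : 0 < η * (c 1 * (γ / 2)) := by have := hc 1; positivity
  obtain ⟨ε₁, hε₁, hconcU⟩ := eventually_abs_setIntegral_sum_sub_le hUi hUm hM'0 hUb hδ'
  obtain ⟨ε₂, hε₂, hconcV⟩ := eventually_abs_setIntegral_sum_sub_le hVi hVm hM'0 hVb hδ'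
  obtain ⟨δ, hδ, hlow⟩ := h.eventually_exp_le_measureReal_sum Δ (lt_min hε₁ hε₂)
  -- Halving makes room for `n + 1`, to which the lower bound is also applied.
  refine ⟨δ / 2, half_pos hδ, ?_⟩
  have hlin : ∀ b c : ℝ, 0 < c → ∀ᶠ L : ℕ in atTop, b ≤ c * L := fun b c hc =>
    (tendsto_natCast_atTop_atTop.const_mul_atTop hc).eventually_ge_atTop b
  filter_upwards [hG, hconcU, hconcV, hlow, hlin 1 (δ / 2) (half_pos hδ),
    hlin (#Δ) (γ / 2) (half_pos hγ), eventually_gt_atTop 0]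
    with L ⟨G, hGL, hGcard, hGx⟩ hcU hcV hlow hL1 hΔ hL0 n hn
  have hL' : (0 : ℝ) < L := by exact_mod_cast hL0
  set A := range L \ Δ with hA
  have hsub : A ⊆ range L := sdiff_subset
  set m := ∑ x ∈ A, P.real {ω | X x ω = 1} with hm
  have hmlow : c 1 * (γ / 2) * L ≤ m := by
    have h1 : #G ≤ #(G \ Δ) + #Δ := by
      have := card_le_card_sdiff_add_card (s := G) (t := Δ); omega
    have h2 : (#G : ℝ) ≤ #(G \ Δ) + #Δ := by exact_mod_cast h1
    calc c 1 * (γ / 2) * L = c 1 * (γ / 2 * L) := by ring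
      _ ≤ c 1 * #(G \ Δ) := by
        have := (hc 1).le
        gcongr
        linarith
      _ = #(G \ Δ) • c 1 := by rw [nsmul_eq_mul, mul_comm]
      _ ≤ ∑ x ∈ G \ Δ, P.real {ω | X x ω = 1} :=
        card_nsmul_le_sum _ _ _ fun x hx => (hGx x (mem_sdiff.1 hx).1).2 1
      _ ≤ m := sum_le_sum_of_subset_of_nonneg (sdiff_subset_sdiff hGL le_rfl)
        fun x _ _ => measureReal_nonneg
  have hexple : ∀ e : ℝ, min ε₁ ε₂ ≤ e → Real.exp (-(e * L)) ≤ Real.exp (-(min ε₁ ε₂ * L)) :=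
    fun e he => by gcongr
  have hq1 := hlow (n + 1) (by
    rw [abs_le] at hn ⊢
    push_cast
    constructor <;> linarith)
  have hq0 := hlow n (hn.trans (by gcongr; linarith))
  have hU' := hcU A hsub {ω | ∑ x ∈ A, X x ω = n + 1} ((hexple _ (min_le_left _ _)).trans hq1)
  have hV' := hcV A hsub {ω | ∑ x ∈ A, X x ω = n} ((hexple _ (min_le_right _ _)).trans hq0)
  have hSm : ∀ i, MeasurableSet {ω | ∑ x ∈ A, X x ω = i} := fun i =>
    h.measurable_sum A (measurableSet_singleton i)
  have huv : ∫ ω in {ω | ∑ x ∈ A, X x ω = n + 1}, ∑ x ∈ A, U x ω ∂P =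
      ∫ ω in {ω | ∑ x ∈ A, X x ω = n}, ∑ x ∈ A, V x ω ∂P := by
    rw [integral_finsetSum _ fun x _ => (hUint x).integrableOn,
      integral_finsetSum _ fun x _ => (hVint x).integrableOn]
    refine sum_congr rfl fun x hx => ?_
    rw [hUind, hVind, integral_indicator_const _ (hmeas x 1), integral_indicator_const _ (hmeas x 0),
      measureReal_restrict_apply (hmeas x 1), measureReal_restrict_apply (hmeas x 0),
      h.exchange (fun x => (hr x).2.2) hx]
    simp [mul_comm]
  simp only [hEU, hEV, ← hm, huv] at hU' hV'
  set q1 := P.real {ω | ∑ x ∈ A, X x ω = n + 1}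
  set q0 := P.real {ω | ∑ x ∈ A, X x ω = n}
  have hq1n : 0 ≤ q1 := measureReal_nonneg
  have hq0n : 0 ≤ q0 := measureReal_nonneg
  have hm0 : 0 < m := lt_of_lt_of_le (by have := hc 1; positivity) hmlow
  have hηm : η * (c 1 * (γ / 2)) * L ≤ η * m := by
    rw [mul_assoc]; gcongr
  have hb1 : η * (c 1 * (γ / 2)) * L * q1 ≤ η * m * q1 := by gcongr
  have hb0 : η * (c 1 * (γ / 2)) * L * q0 ≤ η * m * q0 := by gcongr
  rw [abs_le] at hU' hV'
  have h1η : 0 < 1 - η := by linarith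
  constructor
  · have : m * ((1 - η) * q0) ≤ m * ((1 - η) * ((1 + ε) * q1)) := by
      calc _ ≤ m * ((1 + η) * q1) := by nlinarith
        _ = _ := by rw [hη1]; ring
    exact le_of_mul_le_mul_left (le_of_mul_le_mul_left this hm0) h1η
  · have : m * ((1 - η) * q1) ≤ m * ((1 - η) * ((1 + ε) * q0)) := by
      calc _ ≤ m * ((1 + η) * q0) := by nlinarith
        _ = _ := by rw [hη1]; ring
    exact le_of_mul_le_mul_left (le_of_mul_le_mul_left this hm0) h1η

section Sequences

variable {L N : ℕ → ℕ}

omit [MeasurableSpace Ω] in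
theorem _root_.Condensation.eventually_abs_sub_mul_le (hL : Tendsto L atTop atTop)
    (hN : Tendsto (fun k => (N k : ℝ) / (L k : ℝ)) atTop (𝓝 ρ)) {δ : ℝ} (hδ : 0 < δ) :
    ∀ᶠ k in atTop, |(N k : ℝ) - ρ * L k| ≤ δ * L k := by
  filter_upwards [hN.eventually (Metric.ball_mem_nhds ρ hδ), hL.eventually_gt_atTop 0]
    with k hk hL0
  have hL' : (0 : ℝ) < L k := by exact_mod_cast hL0
  rw [Real.dist_eq] at hk
  rw [← div_le_iff₀ hL', ← abs_of_pos hL', ← abs_div, sub_div, abs_of_pos hL',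
    mul_div_cancel_right₀ _ hL'.ne']
  exact hk.le

theorem _root_.Condensation.tendsto_particles_atTop (hL : Tendsto L atTop atTop) (hρ : 0 < ρ)
    (hN : Tendsto (fun k => (N k : ℝ) / (L k : ℝ)) atTop (𝓝 ρ)) : Tendsto N atTop atTop := by
  have h := hN.pos_mul_atTop hρ ((tendsto_natCast_atTop_atTop (R := ℝ)).comp hL)
  rw [← tendsto_natCast_atTop_iff (R := ℝ)]
  refine h.congr' ?_
  filter_upwards [hL.eventually_gt_atTop 0] with k hk
  have hL' : (0 : ℝ) < L k := by exact_mod_cast hk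
  simp [div_mul_cancel₀ _ hL'.ne']

theorem tendsto_ratio (h : RegularFamily P X ρ) (hρ : 0 < ρ) (Δ : Finset ℕ)
    (hL : Tendsto L atTop atTop)
    (hN : Tendsto (fun k => (N k : ℝ) / (L k : ℝ)) atTop (𝓝 ρ)) (m : ℕ) :
    Tendsto (fun k => P.real {ω | ∑ x ∈ range (L k) \ Δ, X x ω = N k - m} /
      P.real {ω | ∑ x ∈ range (L k) \ Δ, X x ω = N k}) atTop (𝓝 1) := by
  have hN' : ∀ m : ℕ, Tendsto (fun k => ((N k - m : ℕ) : ℝ) / (L k : ℝ)) atTop (𝓝 ρ) := by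
    intro m
    have h0 : Tendsto (fun k => (m : ℝ) / (L k : ℝ)) atTop (𝓝 0) :=
      ((tendsto_natCast_atTop_atTop (R := ℝ)).comp hL).const_div_atTop _
    have := hN.sub h0
    rw [sub_zero] at this
    refine this.congr' ?_
    filter_upwards [(tendsto_particles_atTop hL hρ hN).eventually_ge_atTop m] with k hk
    rw [Nat.cast_sub hk, sub_div]
  have hpos : ∀ m : ℕ, ∀ᶠ k in atTop,
      0 < P.real {ω | ∑ x ∈ range (L k) \ Δ, X x ω = N k - m} := by
    intro m
    obtain ⟨δ, hδ, hlow⟩ := h.eventually_exp_le_measureReal_sum Δ one_pos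
    filter_upwards [hL.eventually hlow, eventually_abs_sub_mul_le hL (hN' m) hδ] with k h1 h2
    exact (Real.exp_pos _).trans_le (h1 _ h2)
  induction m with
  | zero =>
    refine tendsto_const_nhds.congr' ?_
    filter_upwards [hpos 0] with k hk
    rw [Nat.sub_zero] at hk ⊢
    rw [div_self hk.ne']
  | succ m ih =>
    have step : Tendsto (fun k => P.real {ω | ∑ x ∈ range (L k) \ Δ, X x ω = N k - (m + 1)} /
        P.real {ω | ∑ x ∈ range (L k) \ Δ, X x ω = N k - m}) atTop (𝓝 1) := by
      rw [Metric.tendsto_nhds]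
      intro ε hε
      obtain ⟨δ, hδ, hrat⟩ := h.eventually_ratio Δ (half_pos hε)
      filter_upwards [hL.eventually hrat, eventually_abs_sub_mul_le hL (hN' (m + 1)) hδ,
        (tendsto_particles_atTop hL hρ hN).eventually_ge_atTop (m + 1), hpos m] with k h1 h2 h3 h4
      obtain ⟨ha, hb⟩ := h1 _ h2
      rw [show N k - (m + 1) + 1 = N k - m by omega] at ha hb
      set a := P.real {ω | ∑ x ∈ range (L k) \ Δ, X x ω = N k - (m + 1)}
      set b := P.real {ω | ∑ x ∈ range (L k) \ Δ, X x ω = N k - m}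
      rw [Real.dist_eq, abs_lt]
      constructor
      · rw [lt_sub_iff_add_lt, lt_div_iff₀ h4]
        have : 0 < ε * b := by positivity
        have : 0 < 1 + ε / 2 := by positivity
        by_contra! hcon
        have h5 : b ≤ (1 + ε / 2) * ((-ε + 1) * b) := hb.trans (by gcongr)
        nlinarith [mul_pos hε h4, mul_pos (mul_pos hε hε) h4]
      · rw [sub_lt_iff_lt_add, div_lt_iff₀ h4]
        nlinarith
    have := step.mul ih
    rw [one_mul] at this
    refine this.congr' ?_
    filter_upwards [hpos m] with k hk
    rw [div_mul_div_cancel₀ hk.ne']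

/-- This is the domination for all `m` up to `N`. For `m ≤ δL/2` the one-step ratio bound is
iterated. For larger `m` the numerator is at most `1`, and `(1 + ε) ^ m` already beats the
subexponential decay of the denominator. -/
theorem eventually_ratio_le_pow (h : RegularFamily P X ρ) (Δ : Finset ℕ)
    (hL : Tendsto L atTop atTop)
    (hN : Tendsto (fun k => (N k : ℝ) / (L k : ℝ)) atTop (𝓝 ρ)) {ε : ℝ} (hε : 0 < ε) :
    ∀ᶠ k in atTop, ∀ m ≤ N k, P.real {ω | ∑ x ∈ range (L k) \ Δ, X x ω = N k - m} ≤
      (1 + ε) ^ m * P.real {ω | ∑ x ∈ range (L k) \ Δ, X x ω = N k} := by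
  obtain ⟨δ, hδ, hrat⟩ := h.eventually_ratio Δ hε
  have hlog : 0 < Real.log (1 + ε) := Real.log_pos (by linarith)
  obtain ⟨δ', hδ', hlow⟩ := h.eventually_exp_le_measureReal_sum Δ
    (mul_pos (half_pos hδ) hlog)
  filter_upwards [hL.eventually hrat, hL.eventually hlow,
    eventually_abs_sub_mul_le hL hN (half_pos hδ), eventually_abs_sub_mul_le hL hN hδ']
    with k hrat hlow hk hk' m hm
  rcases le_or_gt (m : ℝ) (δ / 2 * L k) with hmL | hmL
  · induction m with
    | zero => simp
    | succ m ih =>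
      have h1 := ih (by omega) (by push_cast at hmL; linarith)
      have h2 := (hrat (N k - (m + 1)) (by
        rw [Nat.cast_sub hm]
        rw [abs_le] at hk ⊢
        have : (0 : ℝ) ≤ ((m + 1 : ℕ) : ℝ) := Nat.cast_nonneg _
        have : (0 : ℝ) ≤ δ / 2 * L k := by positivity
        constructor <;> linarith)).1
      rw [show N k - (m + 1) + 1 = N k - m by omega] at h2
      refine h2.trans ?_
      rw [pow_succ', mul_assoc]
      gcongr
  · have h1 := hlow _ hk'
    calc _ ≤ 1 := measureReal_le_one
      _ = Real.exp (δ / 2 * L k * Real.log (1 + ε)) *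
          Real.exp (-(δ / 2 * Real.log (1 + ε) * L k)) := by
        rw [← Real.exp_add, ← Real.exp_zero]; ring_nf
      _ ≤ Real.exp (m * Real.log (1 + ε)) *
          P.real {ω | ∑ x ∈ range (L k) \ Δ, X x ω = N k} := by gcongr
      _ = _ := by rw [Real.exp_nat_mul, Real.exp_log (by positivity)]

theorem tendsto_log_div (h : RegularFamily P X ρ) (hL : Tendsto L atTop atTop)
    (hN : Tendsto (fun k => (N k : ℝ) / (L k : ℝ)) atTop (𝓝 ρ)) :
    Tendsto (fun k => -Real.log (P.real {ω | ∑ x ∈ range (L k), X x ω = N k}) / L k)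
      atTop (𝓝 0) := by
  rw [Metric.tendsto_nhds]
  intro ε hε
  obtain ⟨δ, hδ, hlow⟩ := h.eventually_exp_le_measureReal_sum ∅ (half_pos hε)
  filter_upwards [hL.eventually hlow, eventually_abs_sub_mul_le hL hN hδ,
    hL.eventually_gt_atTop 0] with k h1 h2 h3
  have hL' : (0 : ℝ) < L k := by exact_mod_cast h3
  have h4 := h1 _ h2
  rw [sdiff_empty] at h4
  have h5 := Real.log_le_log (Real.exp_pos _) h4
  rw [Real.log_exp] at h5
  have h6 : Real.log (P.real {ω | ∑ x ∈ range (L k), X x ω = N k}) ≤ 0 :=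
    Real.log_nonpos measureReal_nonneg measureReal_le_one
  rw [Real.dist_eq, sub_zero, abs_of_nonneg (div_nonneg (by linarith) hL'.le), div_lt_iff₀ hL']
  nlinarith

end Sequences

end RegularFamily

end Ratio

/-! ### Conditional expectations of cylinder functions -/

section Cylinder

variable {P : Measure (ℕ → ℕ)} {ρ : ℝ}

theorem exists_eq_comp_restrict {f : (ℕ → ℕ) → ℝ} {Δ : Finset ℕ}
    (hf : DependsOn f (Δ : Set ℕ)) :
    ∃ F : (Δ → ℕ) → ℝ, ∀ ω : ℕ → ℕ, f ω = F fun x => ω x := by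
  refine ⟨fun u => f fun x => if h : x ∈ Δ then u ⟨x, h⟩ else 0, fun ω => hf fun x hx => ?_⟩
  simp [mem_coe.1 hx]

/-- Split by the number `m` of particles in `Δ` and use that the sites of `A \ Δ` are independent of
`f`. The `if` excludes the values where `N - m` would truncate. -/
theorem RegularFamily.setIntegral_sum_eq [IsProbabilityMeasure P]
    (h : RegularFamily P (fun x ω => ω x) ρ) {f : (ℕ → ℕ) → ℝ} {Δ : Finset ℕ}
    (hf : DependsOn f (Δ : Set ℕ)) (hint : Integrable f P) {A : Finset ℕ} (hA : Δ ⊆ A) (N : ℕ) :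
    ∫ ω in {ω | ∑ x ∈ A, ω x = N}, f ω ∂P =
      ∫ ω, f ω * (if ∑ x ∈ Δ, ω x ≤ N then
        P.real {ω' | ∑ x ∈ A \ Δ, ω' x = N - ∑ x ∈ Δ, ω x} else 0) ∂P := by
  obtain ⟨F, hF⟩ := exists_eq_comp_restrict hf
  have hmS : ∀ (B : Finset ℕ) (n : ℕ), MeasurableSet {ω : ℕ → ℕ | ∑ x ∈ B, ω x = n} := fun B n =>
    h.measurable_sum B (measurableSet_singleton n)
  set T : ℕ → Set (ℕ → ℕ) := fun m => {ω | ∑ x ∈ Δ, ω x = m} with hT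
  set S : ℕ → Set (ℕ → ℕ) := fun n => {ω | ∑ x ∈ A \ Δ, ω x = n} with hS
  have hind : IndepFun (fun (ω : ℕ → ℕ) (x : Δ) => ω x)
      (fun (ω : ℕ → ℕ) (x : (A \ Δ : Finset ℕ)) => ω x) P :=
    h.indep.indepFun_finset Δ (A \ Δ) disjoint_sdiff h.meas
  have hfT : ∀ m, Integrable ((T m).indicator f) P := fun m => hint.indicator (hmS Δ m)
  have hprod : ∀ m n, ∫ ω, (T m).indicator f ω * (S n).indicator (fun _ => (1 : ℝ)) ω ∂P =
      (∫ ω, (T m).indicator f ω ∂P) * P.real (S n) := by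
    intro m n
    have hi : IndepFun ((T m).indicator f) ((S n).indicator fun _ => (1 : ℝ)) P := by
      have := hind.comp (φ := fun u => if ∑ x, u x = m then F u else 0)
        (ψ := fun u => if ∑ x, u x = n then (1 : ℝ) else 0) Measurable.of_discrete
        Measurable.of_discrete
      convert this using 1
      · ext ω
        simp [hT, Set.indicator_apply, hF, Finset.sum_attach _ fun x => ω x]
      · ext ω
        simp only [hS, Set.indicator_apply, Set.mem_ofPred_eq, Function.comp_apply]
        rw [Finset.sum_coe_sort (A \ Δ) fun x => ω x]
    rw [hi.integral_fun_mul_eq_mul_integral (hfT m).aestronglyMeasurable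
      (aestronglyMeasurable_const.indicator (hmS _ n)), integral_indicator_const _ (hmS _ n),
      smul_eq_mul, mul_one]
  have hsum : ∀ ω : ℕ → ℕ, ∑ x ∈ A, ω x = ∑ x ∈ A \ Δ, ω x + ∑ x ∈ Δ, ω x := fun ω =>
    (sum_sdiff hA).symm
  have hpt : ∀ ω, {ω : ℕ → ℕ | ∑ x ∈ A, ω x = N}.indicator f ω =
      ∑ m ∈ range (N + 1), (T m).indicator f ω * (S (N - m)).indicator (fun _ => (1 : ℝ)) ω := by
    intro ω
    simp only [hT, hS, Set.indicator_apply, Set.mem_ofPred_eq, ite_mul, zero_mul,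
      Finset.sum_ite_eq, mem_range, Nat.lt_succ_iff, hsum ω]
    simp only [mul_ite, mul_one, mul_zero]
    split_ifs <;> first | rfl | omega
  have hpt2 : ∀ ω, f ω * (if ∑ x ∈ Δ, ω x ≤ N then P.real (S (N - ∑ x ∈ Δ, ω x)) else 0) =
      ∑ m ∈ range (N + 1), (T m).indicator f ω * P.real (S (N - m)) := by
    intro ω
    simp only [hT, Set.indicator_apply, Set.mem_ofPred_eq, ite_mul, zero_mul, Finset.sum_ite_eq,
      mem_range, Nat.lt_succ_iff, mul_ite, mul_zero]
  rw [← integral_indicator (hmS A N), integral_congr_ae (Eventually.of_forall hpt),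
    integral_finsetSum _ fun m _ => ?_, integral_congr_ae (Eventually.of_forall hpt2),
    integral_finsetSum _ fun m _ => (hfT m).mul_const _]
  · exact sum_congr rfl fun m _ => by rw [hprod, integral_mul_const]
  · have : (fun ω => (T m).indicator f ω * (S (N - m)).indicator (fun _ => (1 : ℝ)) ω) =
        (S (N - m)).indicator ((T m).indicator f) := by
      ext ω; by_cases hω : ω ∈ S (N - m) <;> simp [hω]
    rw [this]
    exact (hfT m).indicator (hmS _ _)

variable {L N : ℕ → ℕ}

theorem RegularFamily.tendsto_setIntegral_div_sdiff [IsProbabilityMeasure P]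
    (h : RegularFamily P (fun x ω => ω x) ρ) (hρ : 0 < ρ)
    (hexp : ∀ Δ : Finset ℕ, ∃ u > 0, ∀ x ∈ Δ, Integrable (fun ω => Real.exp (u * (ω x : ℝ))) P)
    (hL : Tendsto L atTop atTop)
    (hN : Tendsto (fun k => (N k : ℝ) / (L k : ℝ)) atTop (𝓝 ρ))
    {f : (ℕ → ℕ) → ℝ} {Δ : Finset ℕ} (hf : DependsOn f (Δ : Set ℕ)) {ε : ℝ} (hε : 0 < ε)
    (hmem : MemLp f (ENNReal.ofReal (1 + ε)) P) :
    Tendsto (fun k => (∫ ω in {ω | ∑ x ∈ range (L k), ω x = N k}, f ω ∂P) /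
      P.real {ω | ∑ x ∈ range (L k) \ Δ, ω x = N k}) atTop (𝓝 (∫ ω, f ω ∂P)) := by
  obtain ⟨u, hu, hexp⟩ := hexp Δ
  have hpq : (1 + ε).HolderConjugate ((1 + ε) / ε) := by
    rw [Real.holderConjugate_iff]
    refine ⟨by linarith, ?_⟩
    field_simp
  set q := (1 + ε) / ε with hq
  have hq0 : 0 < q := by positivity
  -- Then `exp (t * T)` lies in `L^q`, the dual exponent of `1 + ε`, and its product with `f` is
  -- integrable.
  set t := u / q with ht
  have ht0 : 0 < t := by positivity
  set T : (ℕ → ℕ) → ℕ := fun ω => ∑ x ∈ Δ, ω x with hT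
  have hTm : Measurable T := h.measurable_sum Δ
  have hTexp : MemLp (fun ω => Real.exp (t * T ω)) (ENNReal.ofReal q) P := by
    have hm : Measurable fun ω => Real.exp (t * T ω) :=
      (Measurable.of_discrete (f := fun n : ℕ => Real.exp (t * n))).comp hTm
    rw [← integrable_norm_rpow_iff hm.aestronglyMeasurable (by simpa using hq0)
      ENNReal.ofReal_ne_top, ENNReal.toReal_ofReal hq0.le]
    have hind : iIndepFun (fun (x : ℕ) (ω : ℕ → ℕ) => (ω x : ℝ)) P :=
      h.indep.comp (fun _ (n : ℕ) => (n : ℝ)) fun _ => Measurable.of_discrete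
    have := hind.integrable_exp_mul_sum (t := u) (s := Δ)
      (fun x => (Measurable.of_discrete (f := fun n : ℕ => (n : ℝ))).comp (h.meas x)) hexp
    refine this.congr (Eventually.of_forall fun ω => ?_)
    simp only [Finset.sum_apply, hT, Nat.cast_sum, Real.norm_eq_abs, Real.abs_exp]
    rw [← Real.exp_mul]
    congr 1
    rw [ht]; field_simp
  have : (ENNReal.ofReal (1 + ε)).HolderTriple (ENNReal.ofReal q) 1 := hpq.ennrealOfReal
  have hfint : Integrable f P := hmem.integrable (by
    rw [← ENNReal.ofReal_one]; exact ENNReal.ofReal_le_ofReal (by linarith))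
  have hbound : Integrable (fun ω => ‖f ω‖ * Real.exp (t * T ω)) P := by
    have := (hmem.integrable_mul hTexp).norm
    simpa using this
  -- This `ε` makes the bound `(1 + ε) ^ m` equal to `exp (t * m)`.
  have hpow := h.eventually_ratio_le_pow Δ hL hN (ε := Real.exp t - 1) (by simpa using ht0)
  set Q : ℕ → ℕ → ℝ := fun k n => P.real {ω | ∑ x ∈ range (L k) \ Δ, ω x = n} with hQ
  set g : ℕ → ℕ → ℝ := fun k m => (if m ≤ N k then Q k (N k - m) else 0) / Q k (N k) with hg
  have hmain : Tendsto (fun k => ∫ ω, f ω * g k (T ω) ∂P) atTop (𝓝 (∫ ω, f ω ∂P)) := by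
    refine tendsto_integral_filter_of_dominated_convergence _
      (Eventually.of_forall fun k => ?_) ?_ hbound (Eventually.of_forall fun ω => ?_)
    · exact hfint.aestronglyMeasurable.mul
        ((Measurable.of_discrete (f := g k)).comp hTm).aestronglyMeasurable
    · filter_upwards [hpow] with k hk
      refine Eventually.of_forall fun ω => ?_
      rw [norm_mul]
      gcongr
      have hQ0 : ∀ n, 0 ≤ Q k n := fun n => measureReal_nonneg
      have hg0 : 0 ≤ g k (T ω) := by
        simp only [hg]; split_ifs
        · exact div_nonneg (hQ0 _) (hQ0 _)
        · simp
      rw [Real.norm_of_nonneg hg0]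
      simp only [hg]
      refine div_le_of_le_mul₀ (hQ0 _) (Real.exp_pos _).le ?_
      split_ifs with hle
      · have := hk _ hle
        rwa [add_sub_cancel, ← Real.exp_nat_mul, mul_comm _ t] at this
      · exact mul_nonneg (Real.exp_pos _).le (hQ0 _)
    · have h1 := (h.tendsto_ratio hρ Δ hL hN (T ω)).const_mul (f ω)
      rw [mul_one] at h1
      refine h1.congr' ?_
      filter_upwards [(tendsto_particles_atTop hL hρ hN).eventually_ge_atTop (T ω)] with k hk
      simp [hg, hk, hQ]
  refine hmain.congr' ?_
  filter_upwards [hL.eventually_ge_atTop (Δ.sup id + 1)] with k hk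
  have hsub : Δ ⊆ range (L k) := fun x hx => by
    have : x ≤ Δ.sup id := le_sup (f := id) hx
    rw [mem_range]; omega
  rw [h.setIntegral_sum_eq hf hfint hsub, ← integral_div]
  refine integral_congr_ae (Eventually.of_forall fun ω => ?_)
  simp only [hg, hT, hQ, mul_div_assoc]

theorem RegularFamily.tendsto_setIntegral_div [IsProbabilityMeasure P]
    (h : RegularFamily P (fun x ω => ω x) ρ) (hρ : 0 < ρ)
    (hexp : ∀ Δ : Finset ℕ, ∃ u > 0, ∀ x ∈ Δ, Integrable (fun ω => Real.exp (u * (ω x : ℝ))) P)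
    (hL : Tendsto L atTop atTop)
    (hN : Tendsto (fun k => (N k : ℝ) / (L k : ℝ)) atTop (𝓝 ρ))
    {f : (ℕ → ℕ) → ℝ} {Δ : Finset ℕ} (hf : DependsOn f (Δ : Set ℕ)) {ε : ℝ} (hε : 0 < ε)
    (hmem : MemLp f (ENNReal.ofReal (1 + ε)) P) :
    Tendsto (fun k => (∫ ω in {ω | ∑ x ∈ range (L k), ω x = N k}, f ω ∂P) /
      P.real {ω | ∑ x ∈ range (L k), ω x = N k}) atTop (𝓝 (∫ ω, f ω ∂P)) := by
  have h1 := h.tendsto_setIntegral_div_sdiff hρ hexp hL hN hf hε hmem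
  -- The case `f = 1` compares the sum over all sites with the sum off `Δ`; the quotient cancels the
  -- auxiliary denominator.
  have h2 := h.tendsto_setIntegral_div_sdiff hρ hexp hL hN (f := fun _ => 1) (Δ := Δ)
    (fun _ _ _ => rfl) hε (memLp_const 1)
  have h3 := h1.div h2 (by simp)
  simp only [integral_const, probReal_univ, smul_eq_mul, mul_one, div_one] at h3
  refine h3.congr' ?_
  obtain ⟨δ, hδ, hlow⟩ := h.eventually_exp_le_measureReal_sum Δ one_pos
  filter_upwards [hL.eventually hlow, eventually_abs_sub_mul_le hL hN hδ] with k h4 h5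
  have h6 := (Real.exp_pos _).trans_le (h4 _ h5)
  simp only [Pi.div_apply, measureReal_restrict_apply_univ]
  rw [div_div_div_cancel_right₀ h6.ne']

end Cylinder

/-! ### The canonical measure as a conditioned product measure -/

/-- The density of the conditioned measure is the constant `1 / μ s` on `s`, so the log-likelihood
ratio is constant almost surely. -/
theorem klDiv_cond_self {α : Type*} [MeasurableSpace α] {μ : Measure α} [IsProbabilityMeasure μ]
    {s : Set α} (hs : MeasurableSet s) (hμs : μ s ≠ 0) :
    InformationTheory.klDiv (ProbabilityTheory.cond μ s) μ =
      ENNReal.ofReal (-Real.log (μ.real s)) := by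
  have hprob : IsProbabilityMeasure (ProbabilityTheory.cond μ s) := cond_isProbabilityMeasure hμs
  have hac : ProbabilityTheory.cond μ s ≪ μ := cond_absolutelyContinuous
  have hrn : (ProbabilityTheory.cond μ s).rnDeriv μ =ᵐ[μ] (μ s)⁻¹ • s.indicator 1 := by
    have h1 := Measure.rnDeriv_smul_left_of_ne_top (μ.restrict s) μ (ENNReal.inv_ne_top.2 hμs)
    filter_upwards [h1, Measure.rnDeriv_restrict_self μ hs] with x h1 h2
    rw [ProbabilityTheory.cond, h1, Pi.smul_apply, Pi.smul_apply, h2]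
  have hllr : llr (ProbabilityTheory.cond μ s) μ =ᵐ[ProbabilityTheory.cond μ s]
      fun _ => -Real.log (μ.real s) := by
    filter_upwards [hac.ae_le hrn, ae_cond_mem hs] with x h1 h2
    rw [llr, h1]
    simp [h2, measureReal_def]
  rw [InformationTheory.klDiv_of_ac_of_integrable hac
    ((integrable_const _).congr hllr.symm), integral_congr_ae hllr]
  simp

theorem cond_eq_of_restrict_eq_smul {α : Type*} [MeasurableSpace α] {μ ν : Measure α} {s : Set α}
    {c : ℝ≥0∞} (hc : c ≠ 0) (hc' : c ≠ ∞) (h : μ.restrict s = c • ν.restrict s) :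
    ProbabilityTheory.cond μ s = ProbabilityTheory.cond ν s := by
  have hs : μ s = c * ν s := by
    simpa using congrArg (fun m : Measure α => m Set.univ) h
  rw [ProbabilityTheory.cond, ProbabilityTheory.cond, h, hs, smul_smul,
    ENNReal.mul_inv (Or.inl hc) (Or.inl hc'), mul_right_comm, ENNReal.inv_mul_cancel hc hc', one_mul]

variable {lam : ℕ → ℝ} {w : ℕ → ℕ → ℝ} {φ : ℝ}

theorem siteWeight_eq_mul (hlam : ∀ x, 0 < lam x) (hw : ∀ x n, 0 < w x n) (hφ : 0 ≤ φ) (x n : ℕ) :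
    siteWeight lam w φ x n = ENNReal.ofReal φ ^ n * siteWeight lam w 1 x n := by
  have := (hlam x).le
  have := (hw x n).le
  rw [siteWeight, siteWeight, ← ENNReal.ofReal_pow hφ, ← ENNReal.ofReal_mul (by positivity)]
  congr 1
  ring

theorem sitePartition_ne_zero (hw : ∀ x n, 0 < w x n) (x : ℕ) :
    sitePartition lam w φ x ≠ 0 := by
  refine ENNReal.tsum_eq_zero.not.2 fun h => ?_
  have := h 0
  simp [siteWeight, (hw x 0).not_ge] at this

theorem marginal_singleton (x n : ℕ) :
    marginal lam w φ x {n} = (sitePartition lam w φ x)⁻¹ * siteWeight lam w φ x n := by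
  simp [marginal, withDensity_apply _ (measurableSet_singleton n)]

theorem isProbabilityMeasure_marginal (hw : ∀ x n, 0 < w x n) (hφ : φ ∈ fugacityDomain lam w)
    (x : ℕ) : IsProbabilityMeasure (marginal lam w φ x) := by
  constructor
  rw [marginal, Measure.smul_apply, withDensity_apply _ MeasurableSet.univ, Measure.restrict_univ,
    lintegral_count, smul_eq_mul]
  exact ENNReal.inv_mul_cancel (sitePartition_ne_zero hw x) (hφ.2 x)

/-- On configurations with `N` particles the two weights differ by the constant `φ^N ∏ z_x⁻¹`, which
conditioning does not see. -/
theorem canonical_eq_cond (hlam : ∀ x, 0 < lam x) (hw : ∀ x n, 0 < w x n)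
    (hφ : φ ∈ fugacityDomain lam w) (hφ0 : 0 < φ) (L N : ℕ) :
    canonical lam w L N = ProbabilityTheory.cond (grandCanonical lam w φ L) {η | ∑ x, η x = N} := by
  have hprob : ∀ x, IsProbabilityMeasure (marginal lam w φ x) :=
    isProbabilityMeasure_marginal hw hφ
  set Z := ∏ x : Fin L, (sitePartition lam w φ x)⁻¹ with hZ
  refine (cond_eq_of_restrict_eq_smul (c := Z * ENNReal.ofReal φ ^ N) ?_ ?_ ?_).symm
  · refine mul_ne_zero (prod_ne_zero_iff.2 fun x _ => ENNReal.inv_ne_zero.2 (hφ.2 x)) ?_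
    exact pow_ne_zero _ (ENNReal.ofReal_pos.2 hφ0).ne'
  · refine ENNReal.mul_ne_top (ENNReal.prod_ne_top fun x _ =>
      ENNReal.inv_ne_top.2 (sitePartition_ne_zero hw x)) (by finiteness)
  · refine Measure.ext_of_singleton fun η => ?_
    have hm := measurableSet_singleton η
    rw [Measure.smul_apply, Measure.restrict_apply hm, Measure.restrict_apply hm]
    by_cases hη : ∑ x, η x = N
    · have he : {η} ∩ {η : Fin L → ℕ | ∑ x, η x = N} = {η} := by
        rw [Set.inter_eq_left, Set.singleton_subset_iff]; exact hη
      rw [he, grandCanonical, Measure.pi_singleton, withDensity_apply _ hm]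
      simp only [marginal_singleton, siteWeight_eq_mul hlam hw hφ0.le, prod_mul_distrib,
        Finset.prod_pow_eq_pow_sum, hη, Measure.restrict_singleton, Measure.count_singleton,
        one_smul, lintegral_dirac, smul_eq_mul, ← hZ, mul_assoc]
    · have he : {η} ∩ {η : Fin L → ℕ | ∑ x, η x = N} = ∅ := by
        rw [Set.singleton_inter_eq_empty]; exact hη
      simp [he]

theorem grandCanonical_eq_map (hw : ∀ x n, 0 < w x n) (hφ : φ ∈ fugacityDomain lam w) (L : ℕ) :
    grandCanonical lam w φ L =
      (grandCanonicalInf lam w φ).map fun ω (x : Fin L) => ω x := by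
  have hprob : ∀ x, IsProbabilityMeasure (marginal lam w φ x) :=
    isProbabilityMeasure_marginal hw hφ
  have h1 : iIndepFun (fun (x : ℕ) (ω : ℕ → ℕ) => ω x) (grandCanonicalInf lam w φ) :=
    iIndepFun_infinitePi (X := fun _ n => n) fun _ => measurable_id
  have : IsProbabilityMeasure (grandCanonicalInf lam w φ) := by
    unfold grandCanonicalInf; infer_instance
  have h2 := h1.precomp (Fin.val_injective (n := L))
  rw [(iIndepFun_iff_map_fun_eq_pi_map fun x => (measurable_pi_apply _).aemeasurable).1 h2, grandCanonical]
  congr 1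
  ext1 x
  exact (Measure.infinitePi_map_eval _ _).symm

theorem grandCanonical_real_sum_eq (hw : ∀ x n, 0 < w x n) (hφ : φ ∈ fugacityDomain lam w)
    (L N : ℕ) : (grandCanonical lam w φ L).real {η | ∑ x, η x = N} =
      (grandCanonicalInf lam w φ).real {ω | ∑ x ∈ range L, ω x = N} := by
  rw [grandCanonical_eq_map hw hφ, map_measureReal_apply (by fun_prop) (Set.to_countable _).measurableSet]
  congr 1
  ext ω
  simp [Finset.sum_range]

theorem integral_canonical (hlam : ∀ x, 0 < lam x) (hw : ∀ x n, 0 < w x n)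
    (hφ : φ ∈ fugacityDomain lam w) (hφ0 : 0 < φ) {f : (ℕ → ℕ) → ℝ} {Δ : Finset ℕ}
    (hf : DependsOn f (Δ : Set ℕ)) {L : ℕ} (hL : Δ ⊆ range L) (N : ℕ) :
    ∫ η, f (extendByZero η) ∂(canonical lam w L N) =
      (∫ ω in {ω | ∑ x ∈ range L, ω x = N}, f ω ∂(grandCanonicalInf lam w φ)) /
        (grandCanonicalInf lam w φ).real {ω | ∑ x ∈ range L, ω x = N} := by
  rw [canonical_eq_cond hlam hw hφ hφ0, ProbabilityTheory.cond, integral_smul_measure,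
    ← grandCanonical_real_sum_eq hw hφ, ENNReal.toReal_inv, smul_eq_mul, div_eq_inv_mul,
    ← measureReal_def]
  congr 1
  rw [grandCanonical_eq_map hw hφ, setIntegral_map (Set.to_countable _).measurableSet
    (Measurable.of_discrete).aestronglyMeasurable
    (measurable_pi_lambda _ fun x => measurable_pi_apply _).aemeasurable]
  have : (fun (ω : ℕ → ℕ) (x : Fin L) => ω x) ⁻¹' {η | ∑ x, η x = N} =
      {ω | ∑ x ∈ range L, ω x = N} := by
    ext ω; simp [Finset.sum_range]
  rw [this]
  refine integral_congr_ae (Eventually.of_forall fun ω => hf fun x hx => ?_)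
  simp [extendByZero, mem_range.1 (hL hx)]

theorem klDiv_canonical (hlam : ∀ x, 0 < lam x) (hw : ∀ x n, 0 < w x n)
    (hφ : φ ∈ fugacityDomain lam w) (hφ0 : 0 < φ) {L N : ℕ}
    (h : 0 < (grandCanonicalInf lam w φ).real {ω | ∑ x ∈ range L, ω x = N}) :
    InformationTheory.klDiv (canonical lam w L N) (grandCanonical lam w φ L) =
      ENNReal.ofReal (-Real.log
        ((grandCanonicalInf lam w φ).real {ω | ∑ x ∈ range L, ω x = N})) := by
  have hprob : ∀ x, IsProbabilityMeasure (marginal lam w φ x) :=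
    isProbabilityMeasure_marginal hw hφ
  have : IsProbabilityMeasure (grandCanonical lam w φ L) := by
    unfold grandCanonical; infer_instance
  rw [← grandCanonical_real_sum_eq hw hφ] at h ⊢
  rw [canonical_eq_cond hlam hw hφ hφ0, klDiv_cond_self (Set.to_countable _).measurableSet]
  intro h0
  simp [measureReal_def, h0] at h

/-! ### Power series with subexponential coefficients -/

theorem summable_mul_pow_of_ratio {a : ℕ → ℝ} (ha : ∀ n, 0 < a n)
    (hr : Tendsto (fun n => a (n + 1) / a n) atTop (𝓝 1)) {s : ℝ} (hs : 0 < s) (hs1 : s < 1) :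
    Summable fun n => a n * s ^ n := by
  refine summable_of_ratio_test_tendsto_lt_one hs1
    (Eventually.of_forall fun n => (mul_pos (ha n) (pow_pos hs n)).ne') ?_
  have := hr.mul_const s
  rw [one_mul] at this
  refine this.congr fun n => ?_
  have := ha n
  have := ha (n + 1)
  rw [Real.norm_of_nonneg (by positivity), Real.norm_of_nonneg (by positivity), pow_succ]
  field_simp

theorem not_summable_mul_pow_of_ratio {a : ℕ → ℝ} (ha : ∀ n, 0 < a n)
    (hr : Tendsto (fun n => a (n + 1) / a n) atTop (𝓝 1)) {s : ℝ} (hs : 1 < s) :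
    ¬ Summable fun n => a n * s ^ n := by
  refine not_summable_of_ratio_test_tendsto_gt_one hs ?_
  have := hr.mul_const s
  rw [one_mul] at this
  refine this.congr fun n => ?_
  have := ha n
  have := ha (n + 1)
  rw [Real.norm_of_nonneg (by positivity), Real.norm_of_nonneg (by positivity), pow_succ]
  field_simp

theorem summable_natCast_mul_pow_of_ratio {a : ℕ → ℝ} (ha : ∀ n, 0 < a n)
    (hr : Tendsto (fun n => a (n + 1) / a n) atTop (𝓝 1)) {s : ℝ} (hs : 0 < s) (hs1 : s < 1) :
    Summable fun n : ℕ => n * (a n * s ^ n) := by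
  have h1 : Tendsto (fun n : ℕ => ((n + 1 : ℕ) + 1 : ℝ) * a (n + 1) / ((n + 1 : ℝ) * a n)) atTop
      (𝓝 1) := by
    have h2 : Tendsto (fun n : ℕ => 1 + 1 / ((n : ℝ) + 1)) atTop (𝓝 (1 + 0)) :=
      tendsto_one_div_add_atTop_nhds_zero_nat.const_add 1
    have h3 := h2.mul hr
    rw [add_zero, one_mul] at h3
    refine h3.congr fun n => ?_
    have := ha n
    push_cast
    field_simp
  have h4 := summable_mul_pow_of_ratio (a := fun n => ((n : ℝ) + 1) * a n)
    (fun n => by have := ha n; positivity) h1 hs hs1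
  refine h4.of_nonneg_of_le (fun n => ?_) fun n => ?_
  · have := ha n; positivity
  · have := ha n
    have : 0 ≤ a n * s ^ n := by positivity
    nlinarith

/-! ### Bounds uniform in the site, and monotonicity in the fugacity -/

section Weights

variable {lam : ℕ → ℝ} {w : ℕ → ℕ → ℝ} {wm wp : ℕ → ℝ} {φ φ' : ℝ}

theorem RegularWeights.pos (hw : RegularWeights w wm wp) (x n : ℕ) : 0 < w x n :=
  (hw.wm_pos n).trans_le (hw.lower x n)

theorem RegularWeights.wp_pos (hw : RegularWeights w wm wp) (n : ℕ) : 0 < wp n :=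
  (hw.pos 0 n).trans_le (hw.upper 0 n)

theorem siteWeight_le (hlam : ∀ x, 0 < lam x) (hw : RegularWeights w wm wp) (hφ : 0 ≤ φ) {x : ℕ}
    {s : ℝ} (hs : lam x * φ ≤ s) (n : ℕ) :
    siteWeight lam w φ x n ≤ ENNReal.ofReal (wp n * s ^ n) := by
  have := (hlam x).le
  refine ENNReal.ofReal_le_ofReal ?_
  have := (hw.wp_pos n).le
  gcongr
  exact hw.upper x n

theorem inv_sitePartition_le (hw : RegularWeights w wm wp) (x : ℕ) :
    (sitePartition lam w φ x)⁻¹ ≤ ENNReal.ofReal (wm 0)⁻¹ := by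
  rw [ENNReal.ofReal_inv_of_pos (hw.wm_pos 0), ENNReal.inv_le_inv]
  refine le_trans ?_ (ENNReal.le_tsum 0)
  simpa [siteWeight] using ENNReal.ofReal_le_ofReal (hw.lower x 0)

theorem mul_le_one_of_mem_fugacityDomain (hlam : ∀ x, 0 < lam x) (hw : RegularWeights w wm wp)
    (hφ : φ ∈ fugacityDomain lam w) (x : ℕ) : lam x * φ ≤ 1 := by
  by_contra! hcon
  refine not_summable_mul_pow_of_ratio (hw.pos x) (hw.w_ratio x) hcon ?_
  have h := hφ.2 x
  have hnn : ∀ n, 0 ≤ w x n * (lam x * φ) ^ n := fun n => by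
    have := (hw.pos x n).le
    have := hlam x
    have := hφ.1
    positivity
  have := ENNReal.summable_toReal h
  refine this.congr fun n => ?_
  rw [siteWeight, ENNReal.toReal_ofReal (hnn n)]

theorem le_criticalFugacity (hlam : ∀ x, 0 < lam x) (hw : RegularWeights w wm wp)
    (hφ : φ ∈ fugacityDomain lam w) : φ ≤ criticalFugacity lam w := by
  refine le_csSup ⟨1 / lam 0, fun ψ hψ => ?_⟩ hφ
  rw [le_div_iff₀ (hlam 0), mul_comm]
  exact mul_le_one_of_mem_fugacityDomain hlam hw hψ 0

theorem lintegral_marginal (h : ℕ → ℝ≥0∞) (x : ℕ) :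
    ∫⁻ n, h n ∂(marginal lam w φ x) =
      (sitePartition lam w φ x)⁻¹ * ∑' n, h n * siteWeight lam w φ x n := by
  rw [lintegral_countable', ← ENNReal.tsum_mul_left]
  refine tsum_congr fun n => ?_
  rw [marginal_singleton]
  ring

theorem lintegral_marginal_le (hlam : ∀ x, 0 < lam x) (hw : RegularWeights w wm wp) (hφ : 0 ≤ φ)
    {x : ℕ} {s : ℝ} (hs : lam x * φ ≤ s) (h : ℕ → ℝ≥0∞) :
    ∫⁻ n, h n ∂(marginal lam w φ x) ≤
      ENNReal.ofReal (wm 0)⁻¹ * ∑' n, h n * ENNReal.ofReal (wp n * s ^ n) := by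
  rw [lintegral_marginal]
  gcongr
  · exact inv_sitePartition_le hw x
  · exact siteWeight_le hlam hw hφ hs _

/-- The single-site marginals are stochastically increasing in the fugacity. -/
theorem lintegral_marginal_mono (hlam : ∀ x, 0 < lam x) (hw : ∀ x n, 0 < w x n)
    (hφ : φ ∈ fugacityDomain lam w) (hφ' : φ' ∈ fugacityDomain lam w) (hle : φ' ≤ φ)
    {h : ℕ → ℝ≥0∞} (hh : Monotone h) (x : ℕ) :
    ∫⁻ n, h n ∂(marginal lam w φ' x) ≤ ∫⁻ n, h n ∂(marginal lam w φ x) := by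
  -- At `φ' = 0` the marginal is the point mass at `0`.
  rcases hφ'.1.eq_or_lt with h0 | h0
  · have hprob := isProbabilityMeasure_marginal hw hφ x
    have e : marginal lam w φ' x = Measure.dirac 0 := by
      have hprob' := isProbabilityMeasure_marginal hw hφ' x
      refine Measure.ext_of_singleton fun n => ?_
      have hz : sitePartition lam w φ' x = ENNReal.ofReal (w x 0) := by
        rw [sitePartition, tsum_eq_single 0]
        · simp [siteWeight]
        · intro n hn; simp [siteWeight, ← h0, hn]
      rcases eq_or_ne n 0 with rfl | hn
      · rw [marginal_singleton, hz]
        simp only [siteWeight, pow_zero, mul_one]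
        rw [ENNReal.inv_mul_cancel (ENNReal.ofReal_pos.2 (hw x 0)).ne' ENNReal.ofReal_ne_top]
        simp
      · rw [marginal_singleton]
        simp [siteWeight, ← h0, hn, hn.symm]
    rw [e, lintegral_dirac]
    calc h 0 = ∫⁻ _, h 0 ∂(marginal lam w φ x) := by simp
      _ ≤ _ := lintegral_mono fun n => hh (Nat.zero_le n)
  have h0φ := h0.trans_le hle
  set a := siteWeight lam w φ x
  set r : ℕ → ℝ≥0∞ := fun n => ENNReal.ofReal (φ' / φ) ^ n with hr
  have hra : ∀ n, siteWeight lam w φ' x n = r n * a n := fun n => by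
    rw [show a n = siteWeight lam w φ x n from rfl, siteWeight_eq_mul hlam hw hφ'.1,
      siteWeight_eq_mul hlam hw hφ.1, hr, ← mul_assoc, ← mul_pow,
      ← ENNReal.ofReal_mul (by positivity), div_mul_cancel₀ _ h0φ.ne']
  have hranti : Antitone r := fun i j hij => by
    refine pow_le_pow_right_of_le_one' ?_ hij
    rw [ENNReal.ofReal_le_one]
    exact (div_le_one h0φ).2 hle
  have hz : sitePartition lam w φ x = ∑' n, a n := rfl
  have hz' : sitePartition lam w φ' x = ∑' n, r n * a n := tsum_congr hra
  -- Chebyshev's association inequality for increasing `h` and decreasing `r`, in a symmetrised form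
  -- that needs no subtraction in `ℝ≥0∞`.
  have hpt : ∀ i j, a i * a j * (h i * r i + h j * r j) ≤ a i * a j * (h i * r j + h j * r i) := by
    intro i j
    gcongr _ * ?_
    rcases le_total i j with hij | hij
    · obtain ⟨d, hd⟩ := le_iff_exists_add.1 (hh hij)
      have := hranti hij
      rw [hd]
      calc h i * r i + (h i + d) * r j = h i * r i + h i * r j + d * r j := by ring
        _ ≤ h i * r i + h i * r j + d * r i := by gcongr
        _ = _ := by ring
    · obtain ⟨d, hd⟩ := le_iff_exists_add.1 (hh hij)
      have := hranti hij
      rw [hd]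
      calc (h j + d) * r i + h j * r j = h j * r i + h j * r j + d * r i := by ring
        _ ≤ h j * r i + h j * r j + d * r j := by gcongr
        _ = _ := by ring
  have hdouble := ENNReal.tsum_le_tsum fun i => ENNReal.tsum_le_tsum fun j => hpt i j
  have e1 : ∑' i, ∑' j, a i * a j * (h i * r i + h j * r j) =
      2 * ((∑' n, h n * (r n * a n)) * ∑' n, a n) := by
    calc _ = ∑' i, ∑' j, (h i * (r i * a i) * a j + a i * (h j * (r j * a j))) :=
          tsum_congr fun i => tsum_congr fun j => by ring
      _ = _ := by
        simp only [ENNReal.tsum_add, ENNReal.tsum_mul_left, ENNReal.tsum_mul_right]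
        ring
  have e2 : ∑' i, ∑' j, a i * a j * (h i * r j + h j * r i) =
      2 * ((∑' n, h n * a n) * ∑' n, r n * a n) := by
    calc _ = ∑' i, ∑' j, (h i * a i * (r j * a j) + r i * a i * (h j * a j)) :=
          tsum_congr fun i => tsum_congr fun j => by ring
      _ = _ := by
        simp only [ENNReal.tsum_add, ENNReal.tsum_mul_left, ENNReal.tsum_mul_right]
        ring
  rw [e1, e2, ENNReal.mul_le_mul_iff_right two_ne_zero ENNReal.ofNat_ne_top] at hdouble
  rw [lintegral_marginal, lintegral_marginal, hz, hz']
  simp only [hra]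
  have hA0 : ∑' n, a n ≠ 0 := sitePartition_ne_zero hw x
  have hA : ∑' n, a n ≠ ∞ := hφ.2 x
  have hB0 : ∑' n, r n * a n ≠ 0 := by rw [← hz']; exact sitePartition_ne_zero hw x
  have hB : ∑' n, r n * a n ≠ ∞ := by rw [← hz']; exact hφ'.2 x
  rw [mul_comm, ← div_eq_mul_inv, mul_comm (∑' n, a n)⁻¹, ← div_eq_mul_inv,
    ENNReal.div_le_iff hB0 hB, ENNReal.mul_comm_div]
  rw [← mul_div_assoc, ENNReal.le_div_iff_mul_le (Or.inl hA0) (Or.inl hA)]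
  exact hdouble

theorem lintegral_natCast_sub_add_min (μ : Measure ℕ) (K : ℕ) :
    ∫⁻ n, ((n - K : ℕ) : ℝ≥0∞) ∂μ + ∫⁻ n, ((min n K : ℕ) : ℝ≥0∞) ∂μ =
      ∫⁻ n, (n : ℝ≥0∞) ∂μ := by
  rw [← lintegral_add_left Measurable.of_discrete]
  refine lintegral_congr fun n => ?_
  rw [← Nat.cast_add]
  congr 1
  omega

/-- Since `n = (n - K) + min n K` and `min n K` is increasing in `n`, its mean at `φ'` is at most
that at `φ`. The tail at `φ` therefore exceeds that at `φ'` by no more than the gain in density. -/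
theorem tail_add_siteDensity_le (hlam : ∀ x, 0 < lam x) (hw : ∀ x n, 0 < w x n)
    (hφ : φ ∈ fugacityDomain lam w) (hφ' : φ' ∈ fugacityDomain lam w) (hle : φ' ≤ φ) (K x : ℕ) :
    ∫⁻ n, ((n - K : ℕ) : ℝ≥0∞) ∂(marginal lam w φ x) + siteDensity lam w φ' x ≤
      siteDensity lam w φ x + ∫⁻ n, ((n - K : ℕ) : ℝ≥0∞) ∂(marginal lam w φ' x) := by
  have h1 := lintegral_marginal_mono hlam hw hφ hφ' hle
    (h := fun n => ((min n K : ℕ) : ℝ≥0∞)) (fun i j hij => by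
      exact Nat.mono_cast (min_le_min_right K hij)) x
  rw [siteDensity, siteDensity, ← lintegral_natCast_sub_add_min _ K,
    ← lintegral_natCast_sub_add_min (marginal lam w φ x) K, add_comm (∫⁻ _, _ ∂(marginal lam w φ' x)),
    ← add_assoc]
  gcongr

theorem siteDensity_mono (hlam : ∀ x, 0 < lam x) (hw : ∀ x n, 0 < w x n)
    (hφ : φ ∈ fugacityDomain lam w) (hφ' : φ' ∈ fugacityDomain lam w) (hle : φ' ≤ φ) (x : ℕ) :
    siteDensity lam w φ' x ≤ siteDensity lam w φ x :=
  lintegral_marginal_mono hlam hw hφ hφ' hle Nat.mono_cast x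

theorem HasDensity.mono (hlam : ∀ x, 0 < lam x) (hw : ∀ x n, 0 < w x n) {r r' : ℝ≥0∞}
    (h : HasDensity lam w φ r) (h' : HasDensity lam w φ' r') (hle : φ' ≤ φ) : r' ≤ r := by
  refine le_of_tendsto_of_tendsto' h'.2 h.2 fun L => ?_
  gcongr with x
  exact siteDensity_mono hlam hw h.1 h'.1 hle x

theorem HasDensity.pos {r : ℝ≥0∞} (h : HasDensity lam w φ r) (hr : 0 < r) : 0 < φ := by
  refine h.1.1.lt_of_ne fun h0 => hr.ne' ?_
  refine tendsto_nhds_unique h.2 (tendsto_const_nhds.congr fun L => ?_)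
  have : ∀ x, siteDensity lam w φ x = 0 := fun x => by
    rw [siteDensity, lintegral_marginal]
    refine mul_eq_zero_of_right _ (ENNReal.tsum_eq_zero.2 fun n => ?_)
    rcases eq_or_ne n 0 with rfl | hn
    · simp
    · simp [siteWeight, ← h0, hn]
  simp [this]

theorem HasDensity.siteDensity_ne_top {r : ℝ≥0∞} (h : HasDensity lam w φ r) (hr : r ≠ ∞) (x : ℕ) :
    siteDensity lam w φ x ≠ ∞ := by
  intro hx
  refine hr (tendsto_nhds_unique h.2 (tendsto_const_nhds.congr' ?_))
  filter_upwards [eventually_gt_atTop x] with L hL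
  rw [ENNReal.sum_eq_top.2 ⟨x, mem_range.2 hL, hx⟩, ENNReal.top_div_of_ne_top (by simp)]

theorem HasDensity.tendsto_toReal {r : ℝ≥0∞} (h : HasDensity lam w φ r) (hr : r ≠ ∞) :
    Tendsto (fun L : ℕ => (∑ x ∈ range L, (siteDensity lam w φ x).toReal) / L) atTop
      (𝓝 r.toReal) := by
  refine ((ENNReal.tendsto_toReal hr).comp h.2).congr fun L => ?_
  simp [ENNReal.toReal_sum fun x _ => h.siteDensity_ne_top hr x]

/-- When `λ_x φ` stays away from `1` uniformly, all sites are dominated by the single summable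
sequence `n * wp n * s' ^ n`. -/
theorem exists_tail_le (hlam : ∀ x, 0 < lam x) (hw : RegularWeights w wm wp) (hφ : 0 ≤ φ)
    {s : ℝ} (hs1 : s < 1) (hs : ∀ x, lam x * φ ≤ s) {ε : ℝ} (hε : 0 < ε) :
    ∃ K : ℕ, ∀ x, ∫⁻ n, ((n - K : ℕ) : ℝ≥0∞) ∂(marginal lam w φ x) ≤ ENNReal.ofReal ε := by
  obtain ⟨s', hs'0, hs'1, hss'⟩ : ∃ s' : ℝ, 0 < s' ∧ s' < 1 ∧ s ≤ s' :=
    ⟨max s (1 / 2), by positivity, max_lt hs1 (by norm_num), le_max_left _ _⟩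
  have hsum := summable_natCast_mul_pow_of_ratio hw.wp_pos hw.wp_ratio hs'0 hs'1
  have hb : ∀ n, 0 ≤ wp n * s' ^ n := fun n => by have := hw.wp_pos n; positivity
  set f : ℕ → ℝ≥0∞ := fun n => (n : ℝ≥0∞) * ENNReal.ofReal (wp n * s' ^ n) with hf
  have hfsum : ∑' n, f n ≠ ∞ := by
    have : ∀ n, f n = ENNReal.ofReal (n * (wp n * s' ^ n)) := fun n => by
      rw [ENNReal.ofReal_mul (Nat.cast_nonneg n), ENNReal.ofReal_natCast]
    rw [tsum_congr this, ← ENNReal.ofReal_tsum_of_nonneg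
      (fun n => mul_nonneg (Nat.cast_nonneg n) (hb n)) hsum]
    exact ENNReal.ofReal_ne_top
  have ht := ENNReal.Tendsto.const_mul (ENNReal.tendsto_sum_nat_add f hfsum)
    (Or.inr (ENNReal.ofReal_ne_top (r := (wm 0)⁻¹)))
  rw [mul_zero] at ht
  obtain ⟨K, hK⟩ := (ht.eventually_lt_const (ENNReal.ofReal_pos.2 hε)).exists
  refine ⟨K, fun x => (lintegral_marginal_le hlam hw hφ ((hs x).trans hss') _).trans
    (le_trans ?_ hK.le)⟩
  gcongr _ * ?_
  have hz : ∑ n ∈ range K, ((n - K : ℕ) : ℝ≥0∞) * ENNReal.ofReal (wp n * s' ^ n) = 0 :=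
    sum_eq_zero fun n hn => by simp [Nat.sub_eq_zero_of_le (mem_range.1 hn).le]
  rw [← Summable.sum_add_tsum_nat_add' (k := K) ENNReal.summable, hz, zero_add]
  refine ENNReal.tsum_le_tsum fun n => ?_
  simp only [hf]
  gcongr
  omega

end Weights

/-! ### The grand-canonical measure is a regular family -/

section Grand

variable {lam : ℕ → ℝ} {w : ℕ → ℕ → ℝ} {wm wp : ℕ → ℝ} {φ ρ : ℝ}

theorem isProbabilityMeasure_grandCanonicalInf (hw : ∀ x n, 0 < w x n)
    (hφ : φ ∈ fugacityDomain lam w) : IsProbabilityMeasure (grandCanonicalInf lam w φ) := by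
  have hprob : ∀ x, IsProbabilityMeasure (marginal lam w φ x) :=
    isProbabilityMeasure_marginal hw hφ
  unfold grandCanonicalInf
  infer_instance

theorem grandCanonicalInf_map_eval (hw : ∀ x n, 0 < w x n) (hφ : φ ∈ fugacityDomain lam w)
    (x : ℕ) : (grandCanonicalInf lam w φ).map (fun ω => ω x) = marginal lam w φ x := by
  have hprob : ∀ x, IsProbabilityMeasure (marginal lam w φ x) :=
    isProbabilityMeasure_marginal hw hφ
  exact Measure.infinitePi_map_eval _ x

theorem integral_grandCanonicalInf_natCast (hw : ∀ x n, 0 < w x n)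
    (hφ : φ ∈ fugacityDomain lam w) (x : ℕ) (k : ℕ → ℕ) :
    ∫ ω, (k (ω x) : ℝ) ∂(grandCanonicalInf lam w φ) =
      (∫⁻ n, (k n : ℝ≥0∞) ∂(marginal lam w φ x)).toReal := by
  rw [← grandCanonicalInf_map_eval hw hφ, ← integral_map (φ := fun ω : ℕ → ℕ => ω x)
    (f := fun n => (k n : ℝ)) (measurable_pi_apply x).aemeasurable
    Measurable.of_discrete.aestronglyMeasurable, integral_eq_lintegral_of_nonneg_ae
    (Eventually.of_forall fun n => Nat.cast_nonneg _)
    Measurable.of_discrete.aestronglyMeasurable]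
  simp

theorem integrable_grandCanonicalInf_eval (hw : ∀ x n, 0 < w x n)
    (hφ : φ ∈ fugacityDomain lam w) {x : ℕ} {g : ℕ → ℝ} (hg : ∀ n, 0 ≤ g n)
    (h : ∫⁻ n, ENNReal.ofReal (g n) ∂(marginal lam w φ x) ≠ ∞) :
    Integrable (fun ω => g (ω x)) (grandCanonicalInf lam w φ) := by
  have : Integrable g (marginal lam w φ x) :=
    ⟨Measurable.of_discrete.aestronglyMeasurable,
      (hasFiniteIntegral_iff_ofReal (Eventually.of_forall hg)).2 h.lt_top⟩
  rw [← grandCanonicalInf_map_eval hw hφ] at this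
  exact this.comp_measurable (measurable_pi_apply x)

theorem grandCanonicalInf_real_eval_eq (hlam : ∀ x, 0 < lam x) (hw : ∀ x n, 0 < w x n)
    (hφ : φ ∈ fugacityDomain lam w) (x n : ℕ) :
    (grandCanonicalInf lam w φ).real {ω | ω x = n} =
      (sitePartition lam w φ x).toReal⁻¹ * (w x n * (lam x * φ) ^ n) := by
  have h1 : (grandCanonicalInf lam w φ).real {ω | ω x = n} = (marginal lam w φ x).real {n} := by
    rw [← grandCanonicalInf_map_eval hw hφ,
      map_measureReal_apply (measurable_pi_apply x) (measurableSet_singleton n)]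
    rfl
  rw [h1, measureReal_def, marginal_singleton, ENNReal.toReal_mul, ENNReal.toReal_inv, siteWeight,
    ENNReal.toReal_ofReal]
  have := (hlam x).le
  have := (hw x n).le
  have := hφ.1
  positivity

/-- Sites of small fugacity have small density. -/
theorem exists_siteDensity_le (hlam : ∀ x, 0 < lam x) (hw : RegularWeights w wm wp) (hφ : 0 ≤ φ)
    {η : ℝ} (hη : 0 < η) :
    ∃ t > 0, ∀ x, lam x * φ ≤ t → siteDensity lam w φ x ≤ ENNReal.ofReal η := by
  have hb : ∀ n : ℕ, 0 ≤ n * (wp n * (1 / 2) ^ n) := fun n => by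
    have := hw.wp_pos n; positivity
  have hsum := summable_natCast_mul_pow_of_ratio hw.wp_pos hw.wp_ratio (s := 1 / 2)
    (by norm_num) (by norm_num)
  set S := ∑' n : ℕ, n * (wp n * (1 / 2) ^ n) with hS
  have hS0 : 0 ≤ S := tsum_nonneg hb
  have hm := hw.wm_pos 0
  obtain ⟨t, ht, ht2, htη⟩ : ∃ t : ℝ, 0 < t ∧ t ≤ 1 / 2 ∧ (wm 0)⁻¹ * (2 * t * S) ≤ η := by
    refine ⟨min (1 / 2) (η * wm 0 / (2 * (S + 1))), by positivity, min_le_left _ _, ?_⟩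
    calc _ ≤ (wm 0)⁻¹ * (2 * (η * wm 0 / (2 * (S + 1))) * S) := by
          gcongr; exact min_le_right _ _
      _ = η * (S / (S + 1)) := by field_simp
      _ ≤ η * 1 := by gcongr; rw [div_le_one (by positivity)]; linarith
      _ = η := mul_one η
  refine ⟨t, ht, fun x hx => (lintegral_marginal_le hlam hw hφ hx _).trans ?_⟩
  -- For `n ≥ 1` and `t ≤ 1/2` one has `t ^ n ≤ 2t (1/2) ^ n`; the term `n = 0` vanishes.
  have hpt : ∀ n : ℕ, (n : ℝ≥0∞) * ENNReal.ofReal (wp n * t ^ n) ≤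
      ENNReal.ofReal (2 * t) * ENNReal.ofReal (n * (wp n * (1 / 2) ^ n)) := by
    intro n
    rw [← ENNReal.ofReal_natCast, ← ENNReal.ofReal_mul (Nat.cast_nonneg n),
      ← ENNReal.ofReal_mul (by positivity)]
    refine ENNReal.ofReal_le_ofReal ?_
    rcases n with _ | n
    · simp
    · have := (hw.wp_pos (n + 1)).le
      calc ((n + 1 : ℕ) : ℝ) * (wp (n + 1) * t ^ (n + 1)) =
            ((n + 1 : ℕ) : ℝ) * (wp (n + 1) * (t ^ n * t)) := by rw [pow_succ]
        _ ≤ ((n + 1 : ℕ) : ℝ) * (wp (n + 1) * ((1 / 2) ^ n * t)) := by gcongr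
        _ = _ := by rw [pow_succ]; ring
  calc _ ≤ ENNReal.ofReal (wm 0)⁻¹ *
        ∑' n : ℕ, ENNReal.ofReal (2 * t) * ENNReal.ofReal (n * (wp n * (1 / 2) ^ n)) := by
        gcongr _ * ?_
        exact ENNReal.tsum_le_tsum hpt
    _ = ENNReal.ofReal ((wm 0)⁻¹ * (2 * t * S)) := by
        rw [ENNReal.tsum_mul_left, ← ENNReal.ofReal_tsum_of_nonneg hb hsum,
          ← ENNReal.ofReal_mul (by positivity), ← ENNReal.ofReal_mul (by positivity)]
    _ ≤ _ := ENNReal.ofReal_le_ofReal htη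

/-- `happ` supplies a fugacity with uniform tails whose density is within `ε` of `ρ`; averaging
`tail_add_siteDensity_le` carries its tail bound over to `φ`, also at criticality. -/
theorem exists_tail_sum_le (hlam : ∀ x, 0 < lam x) (hw : RegularWeights w wm wp) (hρ : 0 < ρ)
    (hφ : HasDensity lam w φ (ENNReal.ofReal ρ))
    (happ : ∀ ε > 0, ∃ φ' ≤ φ, ∃ s < 1, (∀ x, lam x * φ' ≤ s) ∧
      ∃ r, HasDensity lam w φ' r ∧ ρ ≤ r.toReal + ε) {ε : ℝ} (hε : 0 < ε) :
    ∃ K : ℕ, ∀ᶠ L : ℕ in atTop, ∑ x ∈ range L,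
      (∫⁻ n, ((n - K : ℕ) : ℝ≥0∞) ∂(marginal lam w φ x)).toReal ≤ ε * L := by
  obtain ⟨φ', hle, s, hs1, hs, r, hr, hρr⟩ := happ (ε / 4) (by positivity)
  obtain ⟨K, hK⟩ := exists_tail_le hlam hw hr.1.1 hs1 hs (ε := ε / 4) (by positivity)
  have hrtop : r ≠ ∞ := ((hφ.mono hlam hw.pos hr hle).trans_lt ENNReal.ofReal_lt_top).ne
  refine ⟨K, ?_⟩
  have h1 := (hφ.tendsto_toReal ENNReal.ofReal_ne_top).eventually_lt_const
    (show (ENNReal.ofReal ρ).toReal < ρ + ε / 4 by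
      rw [ENNReal.toReal_ofReal hρ.le]; linarith)
  have h2 := (hr.tendsto_toReal hrtop).eventually_const_lt
    (show r.toReal - ε / 4 < r.toReal by linarith)
  filter_upwards [h1, h2, eventually_gt_atTop 0] with L h1 h2 hL
  have hL' : (0 : ℝ) < L := by exact_mod_cast hL
  rw [div_lt_iff₀ hL'] at h1
  rw [lt_div_iff₀ hL'] at h2
  have h3 : ∀ x, (∫⁻ n, ((n - K : ℕ) : ℝ≥0∞) ∂(marginal lam w φ x)).toReal +
      (siteDensity lam w φ' x).toReal ≤ (siteDensity lam w φ x).toReal + ε / 4 := by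
    intro x
    have ht := (tail_add_siteDensity_le hlam hw.pos hφ.1 hr.1 hle K x).trans
      (add_le_add le_rfl (hK x))
    have hR := hφ.siteDensity_ne_top ENNReal.ofReal_ne_top x
    have hR' := hr.siteDensity_ne_top hrtop x
    have hrhs : siteDensity lam w φ x + ENNReal.ofReal (ε / 4) ≠ ∞ := by finiteness
    have hT : ∫⁻ n, ((n - K : ℕ) : ℝ≥0∞) ∂(marginal lam w φ x) ≠ ∞ :=
      ne_top_of_le_ne_top hrhs (le_self_add.trans ht)
    rw [← ENNReal.toReal_add hT hR', ← ENNReal.toReal_ofReal (by positivity : 0 ≤ ε / 4),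
      ← ENNReal.toReal_add hR ENNReal.ofReal_ne_top]
    exact ENNReal.toReal_mono hrhs ht
  have h4 := sum_le_sum fun x (_ : x ∈ range L) => h3 x
  rw [sum_add_distrib, sum_add_distrib] at h4
  simp only [sum_const, card_range, nsmul_eq_mul] at h4
  nlinarith

/-- The density cannot come only from bad sites: tails, sites of small fugacity and sites of density
above `16k` account for at most about half of `ρL`, and each remaining site contributes at most `k`
beyond its tail. -/
theorem exists_good_sites (hlam : ∀ x, 0 < lam x) (hw : RegularWeights w wm wp) (hρ : 0 < ρ)
    (hφ : HasDensity lam w φ (ENNReal.ofReal ρ))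
    (happ : ∀ ε > 0, ∃ φ' ≤ φ, ∃ s < 1, (∀ x, lam x * φ' ≤ s) ∧
      ∃ r, HasDensity lam w φ' r ∧ ρ ≤ r.toReal + ε) :
    ∃ γ : ℝ, 0 < γ ∧ ∃ t > 0, ∃ a : ℝ, ∀ᶠ L : ℕ in atTop, ∃ G ⊆ range L,
      γ * L ≤ #G ∧ ∀ x ∈ G, t ≤ lam x * φ ∧ (siteDensity lam w φ x).toReal ≤ a := by
  obtain ⟨K, hK⟩ := exists_tail_sum_le hlam hw hρ hφ happ (ε := ρ / 4) (by positivity)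
  obtain ⟨t, ht, htR⟩ := exists_siteDensity_le hlam hw hφ.1.1 (η := ρ / 8) (by positivity)
  have hlim := hφ.tendsto_toReal ENNReal.ofReal_ne_top
  rw [ENNReal.toReal_ofReal hρ.le] at hlim
  set R : ℕ → ℝ := fun x => (siteDensity lam w φ x).toReal with hR
  have hR0 : ∀ x, 0 ≤ R x := fun x => ENNReal.toReal_nonneg
  set k : ℝ := (K : ℝ) + 1 with hk
  have hk0 : 0 < k := by positivity
  refine ⟨ρ / (4 * k), by positivity, t, ht, 16 * k, ?_⟩
  filter_upwards [hK, hlim.eventually_lt_const (show ρ < 2 * ρ by linarith),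
    hlim.eventually_const_lt (show 3 / 4 * ρ < ρ by linarith), eventually_gt_atTop 0]
    with L hT hup hlow hL
  have hL' : (0 : ℝ) < L := by exact_mod_cast hL
  rw [div_lt_iff₀ hL'] at hup
  rw [lt_div_iff₀ hL'] at hlow
  set G := (range L).filter fun x => t ≤ lam x * φ ∧ R x ≤ 16 * k with hG
  refine ⟨G, filter_subset _ _, ?_, fun x hx => (mem_filter.1 hx).2⟩
  -- The truncated mean is at most `k`, which is below `R x / 16` when `R x > 16k`. Summed over `x`:
  -- `3/4 ρL ≤ (1/4 + 1/8 + 1/8) ρL + k #G`.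
  have hpt : ∀ x, R x ≤ (∫⁻ n, ((n - K : ℕ) : ℝ≥0∞) ∂(marginal lam w φ x)).toReal +
      (ρ / 8 + R x / 16 + if t ≤ lam x * φ ∧ R x ≤ 16 * k then k else 0) := by
    intro x
    have hprob := isProbabilityMeasure_marginal hw.pos hφ.1 x
    set T := ∫⁻ n, ((n - K : ℕ) : ℝ≥0∞) ∂(marginal lam w φ x) with hTdef
    set m := ∫⁻ n, ((min n K : ℕ) : ℝ≥0∞) ∂(marginal lam w φ x) with hmdef
    have hsplit : T + m = siteDensity lam w φ x := lintegral_natCast_sub_add_min _ K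
    have htop := hφ.siteDensity_ne_top ENNReal.ofReal_ne_top x
    have hTm : T ≠ ∞ ∧ m ≠ ∞ := by rw [← ENNReal.add_ne_top, hsplit]; exact htop
    have hsplit' : R x = T.toReal + m.toReal := by
      rw [← ENNReal.toReal_add hTm.1 hTm.2, hsplit]
    have hmk : m.toReal ≤ k := by
      have : m ≤ K := by
        calc m ≤ ∫⁻ _, (K : ℝ≥0∞) ∂(marginal lam w φ x) :=
              lintegral_mono fun n => Nat.mono_cast (min_le_right n K)
          _ = K := by simp
      have := ENNReal.toReal_mono (by simp) this
      rw [ENNReal.toReal_natCast] at this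
      linarith
    have hT0 : 0 ≤ T.toReal := ENNReal.toReal_nonneg
    rw [hsplit']
    gcongr
    have hm0 : 0 ≤ m.toReal := ENNReal.toReal_nonneg
    by_cases h1 : t ≤ lam x * φ
    · by_cases h2 : T.toReal + m.toReal ≤ 16 * k
      · rw [if_pos ⟨h1, h2⟩]; linarith
      · rw [if_neg fun h => h2 h.2]; linarith
    · rw [if_neg fun h => h1 h.1]
      have h3 := ENNReal.toReal_mono ENNReal.ofReal_ne_top (htR x (not_le.1 h1).le)
      rw [ENNReal.toReal_ofReal (by positivity)] at h3
      have h4 : (siteDensity lam w φ x).toReal = T.toReal + m.toReal := hsplit'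
      linarith
  have hsum := sum_le_sum fun x (_ : x ∈ range L) => hpt x
  simp only [sum_add_distrib, sum_const, card_range, nsmul_eq_mul, ← sum_div] at hsum
  rw [← sum_filter, ← hG, sum_const, nsmul_eq_mul] at hsum
  rw [div_mul_eq_mul_div, div_le_iff₀ (by positivity)]
  linarith

theorem regularFamily_grandCanonicalInf (hlam : ∀ x, 0 < lam x) (hw : RegularWeights w wm wp)
    (hρ : 0 < ρ) (hφ : HasDensity lam w φ (ENNReal.ofReal ρ))
    (happ : ∀ ε > 0, ∃ φ' ≤ φ, ∃ s < 1, (∀ x, lam x * φ' ≤ s) ∧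
      ∃ r, HasDensity lam w φ' r ∧ ρ ≤ r.toReal + ε) :
    RegularFamily (grandCanonicalInf lam w φ) (fun x ω => ω x) ρ := by
  have hφ0 : 0 < φ := hφ.pos (ENNReal.ofReal_pos.2 hρ)
  have hprob : ∀ x, IsProbabilityMeasure (marginal lam w φ x) :=
    isProbabilityMeasure_marginal hw.pos hφ.1
  have hPprob := isProbabilityMeasure_grandCanonicalInf hw.pos hφ.1
  have hRtop := hφ.siteDensity_ne_top ENNReal.ofReal_ne_top
  have hE : ∀ x, ∫ ω, (ω x : ℝ) ∂(grandCanonicalInf lam w φ) =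
      (siteDensity lam w φ x).toReal := fun x =>
    integral_grandCanonicalInf_natCast hw.pos hφ.1 x fun n => n
  have hle1 := mul_le_one_of_mem_fugacityDomain hlam hw hφ.1
  have hint : ∀ x, Integrable (fun ω : ℕ → ℕ => (ω x : ℝ)) (grandCanonicalInf lam w φ) :=
    fun x => integrable_grandCanonicalInf_eval hw.pos hφ.1 (g := fun n => (n : ℝ))
      (fun n => Nat.cast_nonneg n) (by simpa [siteDensity] using hRtop x)
  refine ⟨fun x => measurable_pi_apply x,
    iIndepFun_infinitePi (X := fun _ n => n) fun _ => measurable_id, hint, ?_, ?_, ?_, ?_⟩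
  · have := hφ.tendsto_toReal ENNReal.ofReal_ne_top
    rw [ENNReal.toReal_ofReal hρ.le] at this
    simpa only [hE] using this
  · intro ε hε
    obtain ⟨K, hK⟩ := exists_tail_sum_le hlam hw hρ hφ happ hε
    refine ⟨K, hK.mono fun L hL => ?_⟩
    simpa only [integral_grandCanonicalInf_natCast hw.pos hφ.1 _ fun n => n - K] using hL
  · obtain ⟨γ, hγ, t, ht, a, hG⟩ := exists_good_sites hlam hw hρ hφ happ
    -- By Markov a good site holds fewer than `M` particles with probability at least `1/2`. As `λ_x
    -- φ ≤ 1`, this bounds `z_x` by `2W` even where `wp` is not summable.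
    obtain ⟨M, hM, hM0⟩ : ∃ M : ℕ, 2 * a ≤ M ∧ 0 < M := by
      obtain ⟨M, hM⟩ := exists_nat_ge (2 * a)
      exact ⟨M + 1, by push_cast; linarith, M.succ_pos⟩
    set W := ∑ n ∈ range M, wp n with hW
    have hW0 : 0 < W := sum_pos (fun n _ => hw.wp_pos n) ⟨0, mem_range.2 hM0⟩
    refine ⟨γ, hγ, a, fun n => (2 * W)⁻¹ * (wm n * t ^ n), fun n => ?_, hG.mono ?_⟩
    · have := hw.wm_pos n; positivity
    rintro L ⟨G, hGL, hGc, hGx⟩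
    refine ⟨G, hGL, hGc, fun x hx => ?_⟩
    obtain ⟨htx, hax⟩ := hGx x hx
    refine ⟨(hE x).trans_le hax, fun n => ?_⟩
    have hz : (2 * W)⁻¹ ≤ (sitePartition lam w φ x).toReal⁻¹ := by
      have hM' : (0 : ℝ) < M := by exact_mod_cast hM0
      have h1 : (grandCanonicalInf lam w φ).real {ω | (M : ℝ) ≤ ω x} ≤ 1 / 2 := by
        have := mul_meas_ge_le_integral_of_nonneg (μ := grandCanonicalInf lam w φ)
          (Eventually.of_forall fun ω => Nat.cast_nonneg (ω x)) (hint x) M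
        rw [hE] at this
        rw [← mul_le_mul_iff_right₀ hM']
        linarith
      have h2 : 1 ≤ (grandCanonicalInf lam w φ).real {ω | (M : ℝ) ≤ ω x} +
          ∑ n ∈ range M, (grandCanonicalInf lam w φ).real {ω | ω x = n} := by
        calc (1 : ℝ) = (grandCanonicalInf lam w φ).real Set.univ := probReal_univ.symm
          _ ≤ (grandCanonicalInf lam w φ).real
              ({ω | (M : ℝ) ≤ ω x} ∪ ⋃ n ∈ range M, {ω | ω x = n}) := by
            refine measureReal_mono fun ω _ => ?_
            simp only [Set.mem_union, Set.mem_ofPred_eq, Nat.cast_le, Set.mem_iUnion, mem_range,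
              exists_prop, exists_eq_right']
            exact le_or_gt M (ω x)
          _ ≤ _ := (measureReal_union_le _ _).trans
            (add_le_add le_rfl (measureReal_biUnion_finset_le _ _))
      have h3 : ∑ n ∈ range M, (grandCanonicalInf lam w φ).real {ω | ω x = n} ≤
          (sitePartition lam w φ x).toReal⁻¹ * W := by
        rw [hW, mul_sum]
        refine sum_le_sum fun n _ => ?_
        rw [grandCanonicalInf_real_eval_eq hlam hw.pos hφ.1]
        have h4 : (lam x * φ) ^ n ≤ 1 := pow_le_one₀ (by have := hlam x; positivity) (hle1 x)
        have h5 : w x n * (lam x * φ) ^ n ≤ wp n * 1 :=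
          mul_le_mul (hw.upper x n) h4 (by have := hlam x; positivity) (hw.wp_pos n).le
        rw [mul_one] at h5
        gcongr
      rw [mul_inv, ← div_eq_mul_inv, div_le_iff₀ hW0]
      linarith
    rw [grandCanonicalInf_real_eval_eq hlam hw.pos hφ.1]
    have := (hw.wm_pos n).le
    have := (hw.pos x n).le
    have h6 := hw.lower x n
    dsimp only
    gcongr
  · refine ⟨fun x => w x 1 * (lam x * φ) / w x 0, wp 1 / wm 0, fun x => ⟨?_, ?_, ?_⟩⟩
    · have := hw.pos x 1
      have := hw.pos x 0
      have := hlam x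
      positivity
    · have h0 := hw.wm_pos 0
      have h1 := hw.pos x 1
      have h2 := hlam x
      dsimp only
      gcongr
      · exact (hw.wp_pos 1).le
      · calc _ ≤ wp 1 * 1 := mul_le_mul (hw.upper x 1) (hle1 x) (by positivity) (hw.wp_pos 1).le
          _ = wp 1 := mul_one _
      · exact hw.lower x 0
    · have := hw.pos x 0
      rw [grandCanonicalInf_real_eval_eq hlam hw.pos hφ.1,
        grandCanonicalInf_real_eval_eq hlam hw.pos hφ.1]
      field_simp

theorem exists_integrable_exp (hlam : ∀ x, 0 < lam x) (hw : RegularWeights w wm wp)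
    (hφ : φ ∈ fugacityDomain lam w) (hlt : ∀ x, lam x * φ < 1) (Δ : Finset ℕ) :
    ∃ u > 0, ∀ x ∈ Δ,
      Integrable (fun ω => Real.exp (u * (ω x : ℝ))) (grandCanonicalInf lam w φ) := by
  obtain ⟨s, hs0, hs1, hs⟩ : ∃ s : ℝ, 0 < s ∧ s < 1 ∧ ∀ x ∈ Δ, lam x * φ ≤ s := by
    induction Δ using Finset.induction_on with
    | empty => exact ⟨1 / 2, by norm_num, by norm_num, by simp⟩
    | insert y Δ _ ih =>
      obtain ⟨s, hs0, hs1, hs⟩ := ih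
      refine ⟨max s (lam y * φ), lt_max_of_lt_left hs0, max_lt hs1 (hlt y), fun x hx => ?_⟩
      rcases mem_insert.1 hx with rfl | hx
      · exact le_max_right _ _
      · exact (hs x hx).trans (le_max_left _ _)
  -- Then `exp u * s = √s < 1`.
  set u := -Real.log s / 2 with hu
  have hlog : Real.log s < 0 := Real.log_neg hs0 hs1
  have hu0 : 0 < u := by rw [hu]; linarith
  refine ⟨u, hu0, fun x hx => integrable_grandCanonicalInf_eval hw.pos hφ
    (g := fun n => Real.exp (u * n)) (fun n => (Real.exp_pos _).le) ?_⟩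
  have hes : Real.exp u * s < 1 := by
    rw [← Real.exp_log hs0, ← Real.exp_add, Real.exp_lt_one_iff]
    rw [hu]
    linarith
  refine ne_top_of_le_ne_top ?_ (lintegral_marginal_le hlam hw hφ.1 (hs x hx) _)
  refine ENNReal.mul_ne_top ENNReal.ofReal_ne_top ?_
  have hsum := summable_mul_pow_of_ratio hw.wp_pos hw.wp_ratio (s := Real.exp u * s)
    (by positivity) hes
  have e : ∀ n : ℕ, ENNReal.ofReal (Real.exp (u * n)) * ENNReal.ofReal (wp n * s ^ n) =
      ENNReal.ofReal (wp n * (Real.exp u * s) ^ n) := fun n => by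
    rw [← ENNReal.ofReal_mul (Real.exp_pos _).le, mul_comm u, Real.exp_nat_mul, mul_pow]
    ring_nf
  rw [tsum_congr e, ← ENNReal.ofReal_tsum_of_nonneg (fun n => by
    have := hw.wp_pos n; positivity) hsum]
  exact ENNReal.ofReal_ne_top

variable {L N : ℕ → ℕ}

theorem entropyConverges_of_regularFamily (hlam : ∀ x, 0 < lam x) (hw : RegularWeights w wm wp)
    (hφ : φ ∈ fugacityDomain lam w) (hφ0 : 0 < φ)
    (h : RegularFamily (grandCanonicalInf lam w φ) (fun x ω => ω x) ρ)
    (hL : Tendsto L atTop atTop) (hN : Tendsto (fun k => (N k : ℝ) / (L k : ℝ)) atTop (𝓝 ρ)) :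
    EntropyConverges lam w φ L N := by
  have hPprob := isProbabilityMeasure_grandCanonicalInf hw.pos hφ
  have h1 := ENNReal.tendsto_ofReal (h.tendsto_log_div hL hN)
  rw [ENNReal.ofReal_zero] at h1
  refine h1.congr' ?_
  obtain ⟨δ, hδ, hlow⟩ := h.eventually_exp_le_measureReal_sum ∅ one_pos
  filter_upwards [hL.eventually hlow, eventually_abs_sub_mul_le hL hN hδ,
    hL.eventually_gt_atTop 0] with k h2 h3 h4
  have h5 := (Real.exp_pos _).trans_le (h2 _ h3)
  rw [sdiff_empty] at h5
  rw [klDiv_canonical hlam hw.pos hφ hφ0 h5, ENNReal.ofReal_div_of_pos (by exact_mod_cast h4),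
    ENNReal.ofReal_natCast]

theorem cylinderConverges_of_regularFamily (hlam : ∀ x, 0 < lam x) (hw : RegularWeights w wm wp)
    (hφ : φ ∈ fugacityDomain lam w) (hφ0 : 0 < φ) (hlt : ∀ x, lam x * φ < 1) (hρ : 0 < ρ)
    (h : RegularFamily (grandCanonicalInf lam w φ) (fun x ω => ω x) ρ)
    (hL : Tendsto L atTop atTop) (hN : Tendsto (fun k => (N k : ℝ) / (L k : ℝ)) atTop (𝓝 ρ)) :
    CylinderConverges lam w φ L N := by
  intro f Δ ε hf hε hmem
  have hPprob := isProbabilityMeasure_grandCanonicalInf hw.pos hφ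
  have h1 := h.tendsto_setIntegral_div hρ (exists_integrable_exp hlam hw hφ hlt) hL hN hf
    hε hmem
  refine h1.congr' ?_
  filter_upwards [hL.eventually_ge_atTop (Δ.sup id + 1)] with k hk
  rw [integral_canonical hlam hw.pos hφ hφ0 hf]
  intro x hx
  have : x ≤ Δ.sup id := le_sup (f := id) hx
  rw [mem_range]; omega

end Grand

/-! ### Position of the fugacity relative to the critical one -/

section Critical

variable {lam : ℕ → ℝ} {w : ℕ → ℕ → ℝ} {wm wp : ℕ → ℝ} {φ ρ : ℝ} {ρc : ℝ≥0∞}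

theorem exists_mul_le_of_lt_criticalFugacity (hlam : ∀ x, 0 < lam x)
    (hw : RegularWeights w wm wp) (hφ : φ ∈ fugacityDomain lam w)
    (hlt : φ < criticalFugacity lam w) : ∃ s < 1, ∀ x, lam x * φ ≤ s := by
  obtain ⟨ψ, hψ, hlt'⟩ := exists_lt_of_lt_csSup ⟨φ, hφ⟩ hlt
  have hψ0 : 0 < ψ := hφ.1.trans_lt hlt'
  refine ⟨φ / ψ, (div_lt_one hψ0).2 hlt', fun x => ?_⟩
  have h1 := mul_le_one_of_mem_fugacityDomain hlam hw hψ x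
  have h2 := hφ.1
  rw [le_div_iff₀ hψ0]
  nlinarith

theorem lt_criticalFugacity_of_lt (hlam : ∀ x, 0 < lam x) (hw : RegularWeights w wm wp)
    (hρc : IsCriticalDensity lam w ρc) (hρ : 0 < ρ) (hφ : HasDensity lam w φ (ENNReal.ofReal ρ))
    (hlt : ENNReal.ofReal ρ < ρc) : φ < criticalFugacity lam w := by
  by_contra! hcon
  obtain ⟨R, hR, hlim⟩ := hρc
  have hφ0 : 0 < φ := hφ.pos (ENNReal.ofReal_pos.2 hρ)
  have hc0 : 0 < criticalFugacity lam w := hφ0.trans_le (le_criticalFugacity hlam hw hφ.1)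
  refine hlt.not_ge (le_of_tendsto hlim ?_)
  filter_upwards [Ioo_mem_nhdsLT hc0] with ψ hψ
  exact hφ.mono hlam hw.pos (hR ψ hψ.1.le hψ.2) (hψ.2.le.trans hcon)

/-- `R(ψ) → ρ_c = ρ` as `ψ` increases to `φ_c`, and every `ψ` below `φ_c` keeps `λ_x ψ` uniformly
below `1`. -/
theorem exists_approx_of_eq_criticalFugacity (hlam : ∀ x, 0 < lam x)
    (hw : RegularWeights w wm wp) (hρc : IsCriticalDensity lam w ρc) (hρ : 0 < ρ)
    (hφ : HasDensity lam w φ (ENNReal.ofReal ρ)) (heq : ENNReal.ofReal ρ = ρc)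
    (hφc : φ = criticalFugacity lam w) {ε : ℝ} (hε : 0 < ε) :
    ∃ φ' ≤ φ, ∃ s < 1, (∀ x, lam x * φ' ≤ s) ∧
      ∃ r, HasDensity lam w φ' r ∧ ρ ≤ r.toReal + ε := by
  obtain ⟨R, hR, hlim⟩ := hρc
  have hφ0 : 0 < φ := hφ.pos (ENNReal.ofReal_pos.2 hρ)
  rw [← hφc, ← heq] at hlim
  rw [← hφc] at hR
  have h1 := ((ENNReal.tendsto_toReal ENNReal.ofReal_ne_top).comp hlim).eventually_const_lt
    (show ρ - ε < (ENNReal.ofReal ρ).toReal by rw [ENNReal.toReal_ofReal hρ.le]; linarith)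
  obtain ⟨ψ, hψ1, hψ2⟩ := (h1.and (Ioo_mem_nhdsLT hφ0)).exists
  have hd := hR ψ hψ2.1.le hψ2.2
  obtain ⟨s, hs1, hs⟩ := exists_mul_le_of_lt_criticalFugacity hlam hw hd.1 (hφc ▸ hψ2.2)
  refine ⟨ψ, hψ2.2.le, s, hs1, hs, R ψ, hd, ?_⟩
  simp only [Function.comp_apply] at hψ1
  linarith

/-- A site with finite density at which `λ_x φ` reaches `1` forces a finite first moment of `wm`. -/
theorem mul_lt_one_of_not_summable (hw : RegularWeights w wm wp)
    (hφ : φ ∈ fugacityDomain lam w) {x : ℕ} (hR : siteDensity lam w φ x ≠ ∞)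
    (hns : ¬ Summable fun n : ℕ => (n : ℝ) * wm n) : lam x * φ < 1 := by
  by_contra! hcon
  refine hns ?_
  rw [siteDensity, lintegral_marginal] at hR
  have h1 : ∑' n : ℕ, (n : ℝ≥0∞) * siteWeight lam w φ x n ≠ ∞ := by
    intro h
    rw [h, ENNReal.mul_top (ENNReal.inv_ne_zero.2 (hφ.2 x))] at hR
    exact hR rfl
  have h2 := ENNReal.summable_toReal h1
  refine h2.of_nonneg_of_le (fun n => mul_nonneg (Nat.cast_nonneg n) (hw.wm_pos n).le) fun n => ?_
  have hwx := (hw.pos x n).le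
  have h3 : wm n ≤ w x n * (lam x * φ) ^ n := by
    calc wm n ≤ w x n * 1 := by rw [mul_one]; exact hw.lower x n
      _ ≤ _ := by gcongr; exact one_le_pow₀ hcon
  rw [ENNReal.toReal_mul, ENNReal.toReal_natCast, siteWeight,
    ENNReal.toReal_ofReal ((hw.wm_pos n).le.trans h3)]
  gcongr

end Critical

end Condensation

theorem mainTheorem1
    (lam : ℕ → ℝ) (hlam_pos : ∀ x, 0 < lam x) (hlam_bdd : ∃ C : ℝ, ∀ x, lam x ≤ C)
    (w : ℕ → ℕ → ℝ) (wm wp : ℕ → ℝ) (hw : RegularWeights w wm wp)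
    (ρc : ℝ≥0∞) (hρc : IsCriticalDensity lam w ρc)
    (ρ : ℝ) (hρ : 0 < ρ) (φ : ℝ) (hφ : HasDensity lam w φ (ENNReal.ofReal ρ))
    (L N : ℕ → ℕ) (hL : Tendsto L atTop atTop)
    (hN : Tendsto (fun k => (N k : ℝ) / (L k : ℝ)) atTop (𝓝 ρ)) :
    (ENNReal.ofReal ρ < ρc →
      EntropyConverges lam w φ L N ∧ CylinderConverges lam w φ L N) ∧
    (ENNReal.ofReal ρ = ρc → φ = criticalFugacity lam w →
      (∀ x, ∫⁻ n, (n : ℝ≥0∞) ^ 2 ∂(marginal lam w φ x) < ∞) →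
        EntropyConverges lam w φ L N ∧
        (((¬ Summable fun n : ℕ => (n : ℝ) * wm n) ∨
            ∀ x, lam x < 1 / criticalFugacity lam w) →
          CylinderConverges lam w φ L N)) := by
  have hφ0 : 0 < φ := hφ.pos (ENNReal.ofReal_pos.2 hρ)
  refine ⟨fun hlt => ?_, fun heq hφc _ => ?_⟩
  · obtain ⟨s, hs1, hs⟩ := exists_mul_le_of_lt_criticalFugacity hlam_pos hw hφ.1
      (lt_criticalFugacity_of_lt hlam_pos hw hρc hρ hφ hlt)
    -- Below `φ_c` the fugacity serves as its own approximation.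
    have h := regularFamily_grandCanonicalInf hlam_pos hw hρ hφ fun ε hε =>
      ⟨φ, le_rfl, s, hs1, hs, _, hφ, by rw [ENNReal.toReal_ofReal hρ.le]; linarith⟩
    exact ⟨entropyConverges_of_regularFamily hlam_pos hw hφ.1 hφ0 h hL hN,
      cylinderConverges_of_regularFamily hlam_pos hw hφ.1 hφ0 (fun x => (hs x).trans_lt hs1) hρ h
        hL hN⟩
  · have h := regularFamily_grandCanonicalInf hlam_pos hw hρ hφ fun ε hε =>
      exists_approx_of_eq_criticalFugacity hlam_pos hw hρc hρ hφ heq hφc hε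
    refine ⟨entropyConverges_of_regularFamily hlam_pos hw hφ.1 hφ0 h hL hN, fun hor =>
      cylinderConverges_of_regularFamily hlam_pos hw hφ.1 hφ0 (fun x => ?_) hρ h hL hN⟩
    rcases hor with hns | hlt
    · exact mul_lt_one_of_not_summable hw hφ.1
        (hφ.siteDensity_ne_top ENNReal.ofReal_ne_top x) hns
    · have := hlt x
      rwa [← hφc, lt_div_iff₀ hφ0] at this
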